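/- **Proposition.** Let $f$ be a Bernstein function with Lévy triplet $(a,b,\bar\nu)$, i.e. $f(\lambda)=a+b\lambda+\int_{(0,\infty)}(1-e^{-s\lambda})\,\bar\nu(ds)$ for $\lambda>0$, where $a,b\ge 0$ and $\bar\nu$ is a measure on $(0,\infty)$ with $\int (z\wedge 1)\,\bar\nu(dz)<\infty$; let $\nu(s)=a+\bar\nu(s,\infty)$, $s>0$. Let $\sigma=(\sigma(t))_{t\ge0}$ be a (possibly killed) subordinator with Laplace exponent $f$ and transition probabilities $\mu_t(B)=\Pr\{\sigma(t)\in B\}$, $B\subseteq[0,\infty)$ Borel, so that $\int_{[0,\infty)} e^{-\lambda s}\mu_t(ds)=e^{-tf(\lambda)}$ for $\lambda>0$, $t\ge 0$. Let $1\le p<\infty$, and consider real- or complex-valued functions. Let $T^l_su(x)=u(x+s)$, $s\ge0$, be the left translation semigroup on $L^p(\mathbb R)$, and let $W^{1,p}(\mathbb R)$ be the set of $u\in L^p(\mathbb R)$ that are (locally) absolutely continuous with $u'\in L^p(\mathbb R)$. For $u\in W^{1,p}(\mathbb R)$ put $$ {}^f\mathcal D_x^-u(x)=-\Big[b\,u'(x)+\int_0^\infty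 \tfrac{\partial}{\partial x}u(x+s)\,\nu(s)\,ds\Big],\qquad \int_0^\infty=\lim_{R\to\infty}\int_0^R ,$$ for almost every $x$. Then: 1. For $t\ge0$ and $u\in L^p(\mathbb R)$ the integral $$Q_tu(x)=\int_{[0,\infty)}u(x+y)\,\mu_t(dy)$$ converges absolutely for a.e. $x$, and $Q_tu=\int_{[0,\infty)}T^l_su\,\mu_t(ds)$ as a Bochner integral in $L^p(\mathbb R)$; that is, $Q_t$ is the left translation semigroup subordinated in the sense of Bochner. The family $(Q_t)_{t\ge0}$ is a contractive $C_0$-semigroup on $L^p(\mathbb R)$. 2. For $u\in W^{1,p}(\mathbb R)$ the function $q(t)=Q_tu$ is the solution of $$\frac{\partial}{\partial t}q(t)=-\,{}^f\mathcal D_x^-q(t),\quad 0<t<\infty,\qquad q(0)=u,$$ where a solution is a continuous function $q:[0,\infty)\to L^p(\mathbb R)$ which for $t>0$ takes values in $W^{1,p}(\mathbb R)$, is differentiable in $L^p(\mathbb R)$, and satisfies the equation (with ${}^f\mathcal D_x^-q(t)\in L^p(\mathbb R)$ defined a.e. as above); it is the only one. 3. On $W^{1,p}(\mathbb R)$ the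 operator $-\,{}^f\mathcal D_x^-$ coincides with the infinitesimal generator of $(Q_t)$ and with Phillips' expression: every $u\in W^{1,p}(\mathbb R)$ is in the domain of the generator $\partial_x$ of $(T^l_s)$ and in the domain of the generator of $(Q_t)$, the latter takes at $u$ the value $$-f(-\partial_x)u:=-au+b\,\partial_xu+\int_{(0,\infty)}(T^l_su-u)\,\bar\nu(ds)$$ (a convergent Bochner integral in $L^p(\mathbb R)$), and ${}^f\mathcal D_x^-u$ exists almost everywhere with $-\,{}^f\mathcal D_x^-u=-f(-\partial_x)u$ a.e. -/

import Mathlib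

open MeasureTheory Set Filter Topology
open scoped NNReal ENNReal

noncomputable section

/-! ### Bernstein functions and subordinators -/

/-- `f` is the Bernstein function with Lévy triplet `(a, b, νbar)`. The Lévy measure on `(0, ∞)` is
a measure on `[0, ∞)` without mass at `0`. Only the values of `f` on `(0, ∞)` matter. -/
structure IsBernsteinWithTriplet (f : ℝ → ℝ) (a b : ℝ) (νbar : Measure ℝ≥0) : Prop where
  a_nonneg : 0 ≤ a
  b_nonneg : 0 ≤ b
  no_mass_zero : νbar {0} = 0
  integrability : ∫⁻ z, ((min z 1 : ℝ≥0) : ℝ≥0∞) ∂νbar < ∞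
  levyKhintchine : ∀ x : ℝ, 0 < x →
    f x = a + b * x + ∫ s : ℝ≥0, (1 - Real.exp (-((s : ℝ) * x))) ∂νbar

/-- The tail `ν(s) = a + νbar (s, ∞)` of the Lévy measure (used for `s > 0`). -/
def levyTail (a : ℝ) (νbar : Measure ℝ≥0) (s : ℝ) : ℝ :=
  a + νbar.real {z : ℝ≥0 | s < (z : ℝ)}

/-- A (possibly killed) subordinator: a process with values in `[0, ∞]`, started at `0`, with
non-decreasing right-continuous paths (so that `∞` is absorbing), whose increments are independent
of the past and homogeneous up to the lifetime `ζ = inf {t | σ t = ∞}`: given the past up to `t`,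
on the event `{t < ζ} = {σ t < ∞}`, the increment `σ (t + s) - σ t` has the law of `σ s`. -/
structure IsSubordinator {Ω : Type*} [MeasurableSpace Ω] (P : Measure Ω)
    (σ : ℝ≥0 → Ω → ℝ≥0∞) : Prop where
  measurable : ∀ t, Measurable (σ t)
  zero : ∀ᵐ ω ∂P, σ 0 ω = 0
  monotone : ∀ᵐ ω ∂P, Monotone fun t => σ t ω
  rightContinuous : ∀ᵐ ω ∂P, ∀ t, ContinuousWithinAt (fun r => σ r ω) (Ici t) t
  increments : ∀ (t s : ℝ≥0) (A : Set Ω) (B : Set ℝ≥0∞),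
    MeasurableSet[⨆ r ∈ Iic t, MeasurableSpace.comap (σ r) inferInstance] A → MeasurableSet B →
      P (A ∩ {ω | σ t ω ≠ ∞} ∩ {ω | σ (t + s) ω - σ t ω ∈ B}) =
        P (A ∩ {ω | σ t ω ≠ ∞}) * P {ω | σ s ω ∈ B}

/-- The transition probabilities `μ_t(B) = P(σ t ∈ B)`, `B ⊆ [0, ∞)` Borel: a sub-probability
measure on `[0, ∞)`. -/
def transitionProb {Ω : Type*} [MeasurableSpace Ω] (P : Measure Ω)
    (σ : ℝ≥0 → Ω → ℝ≥0∞) (t : ℝ≥0) : Measure ℝ≥0 :=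
  (P.restrict {ω | σ t ω ≠ ∞}).map fun ω => (σ t ω).toNNReal

/-- `f` is the Laplace exponent of `σ`: `∫ e^{-λ s} μ_t(ds) = e^{-t f(λ)}` for `λ > 0`. -/
def HasLaplaceExponent {Ω : Type*} [MeasurableSpace Ω] (P : Measure Ω)
    (σ : ℝ≥0 → Ω → ℝ≥0∞) (f : ℝ → ℝ) : Prop :=
  ∀ (t : ℝ≥0) (l : ℝ), 0 < l →
    ∫ s : ℝ≥0, Real.exp (-(l * (s : ℝ))) ∂(transitionProb P σ t) = Real.exp (-((t : ℝ) * f l))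

/-! ### Semigroups of operators, generators, subordination -/

section Semigroups

variable {𝕜 B : Type*} [RCLike 𝕜] [NormedAddCommGroup B] [NormedSpace ℝ B] [NormedSpace 𝕜 B]

/-- Strongly continuous (`C₀`) semigroups of bounded operators. -/
structure IsC0Semigroup (T : ℝ≥0 → B →L[𝕜] B) : Prop where
  zero : T 0 = ContinuousLinearMap.id 𝕜 B
  add : ∀ s t, T (s + t) = (T s).comp (T t)
  tendsto : ∀ u, Tendsto (fun t => T t u) (𝓝 0) (𝓝 u)

/-- `u` is in the domain of the infinitesimal generator of `T`, whose value at `u` is `v`. -/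
def IsGeneratorValue (T : ℝ≥0 → B →L[𝕜] B) (u v : B) : Prop :=
  Tendsto (fun h : ℝ≥0 => (h : ℝ)⁻¹ • (T h u - u)) (𝓝[>] 0) (𝓝 v)

/-- Phillips' expression `-f(-A) u = -a u + b A u + ∫ (T_s u - u) νbar(ds)` (a Bochner integral) for
the semigroup `T`, where `Au` stands for the value at `u` of the generator `A` of `T`. -/
def phillips (a b : ℝ) (νbar : Measure ℝ≥0) (T : ℝ≥0 → B →L[𝕜] B) (u Au : B) : B :=
  -(a • u) + b • Au + ∫ s, (T s u - u) ∂νbar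

end Semigroups

/-! ### Functions on the line: translations, `W^{1,p}` and the left Weyl-type derivative -/

section Line

variable {𝕜 : Type*} [RCLike 𝕜]

/-- The left translation semigroup `u ↦ u (· + s)` on `L^p(ℝ)`. -/
def leftTranslation (𝕜 : Type*) [RCLike 𝕜] (p : ℝ≥0∞) [Fact (1 ≤ p)] (s : ℝ≥0) :
    Lp 𝕜 p (volume : Measure ℝ) →L[𝕜] Lp 𝕜 p (volume : Measure ℝ) :=
  (Lp.compMeasurePreservingₗᵢ 𝕜 (fun x : ℝ => x + (s : ℝ))
    (measurePreserving_add_right (volume : Measure ℝ) (s : ℝ))).toContinuousLinearMap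

/-- A function belongs to `W^{1,p}(ℝ)`: it is in `L^p`, (locally) absolutely continuous, and its
derivative, which exists almost everywhere, is in `L^p`. -/
structure MemW1p (p : ℝ≥0∞) (g : ℝ → 𝕜) : Prop where
  memLp : MemLp g p volume
  absCont : ∀ c d : ℝ, AbsolutelyContinuousOnInterval g c d
  memLp_deriv : MemLp (deriv g) p volume

/-- The class `u ∈ L^p(ℝ)` is that of a function in `W^{1,p}(ℝ)`, with derivative `∂u/∂x = du`. -/
def HasSpaceDeriv {p : ℝ≥0∞} (u du : Lp 𝕜 p (volume : Measure ℝ)) : Prop :=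
  ∃ g : ℝ → 𝕜, MemW1p p g ∧ u =ᵐ[volume] g ∧ du =ᵐ[volume] deriv g

/-- The class `u ∈ L^p(ℝ)` belongs to `W^{1,p}(ℝ)`. -/
def InW1p {p : ℝ≥0∞} (u : Lp 𝕜 p (volume : Measure ℝ)) : Prop :=
  ∃ g : ℝ → 𝕜, MemW1p p g ∧ u =ᵐ[volume] g

/-- At the point `x`, the expression
`- [b g'(x) + ∫_0^∞ (∂/∂x) g(x + s) ν(s) ds]`, with `ν` the tail of the Lévy measure, is well defined
and equal to `d`. The integral over `(0, ∞)` is `lim_{R → ∞} ∫_0^R`, where the integrals over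
`(0, R]` converge absolutely: for `p > 1` and `g' ∈ L^p` the function `s ↦ g'(x + s) ν(s)` need not be
absolutely integrable at infinity. -/
def HasLeftWeylDerivAt (a b : ℝ) (νbar : Measure ℝ≥0) (g : ℝ → 𝕜) (d : 𝕜) (x : ℝ) : Prop :=
  DifferentiableAt ℝ g x ∧
  (∀ R : ℝ, IntegrableOn (fun s => levyTail a νbar s • deriv g (x + s)) (Ioc 0 R) volume) ∧
  ∃ I : 𝕜,
    Tendsto (fun R : ℝ => ∫ s in Ioc 0 R, levyTail a νbar s • deriv g (x + s)) atTop (𝓝 I) ∧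
    d = -(b • deriv g x + I)

/-- The class `u ∈ L^p(ℝ)` is in `W^{1,p}(ℝ)`, and the left Weyl-type derivative of (the absolutely
continuous representative of) `u` exists almost everywhere and is equal to `w ∈ L^p(ℝ)`. -/
def IsLeftWeylDeriv (a b : ℝ) (νbar : Measure ℝ≥0) {p : ℝ≥0∞}
    (u w : Lp 𝕜 p (volume : Measure ℝ)) : Prop :=
  ∃ g : ℝ → 𝕜, MemW1p p g ∧ u =ᵐ[volume] g ∧
    ∀ᵐ x : ℝ, HasLeftWeylDerivAt a b νbar g (w x) x

/-- `q : [0, ∞) → L^p(ℝ)` solves `∂q/∂t = -D q` for `t > 0`, `q(0) = u`, where `D` is the left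
Weyl-type derivative on `W^{1,p}(ℝ)`: `q` is continuous on `[0, ∞)`, and for `t > 0` it takes its
values in `W^{1,p}(ℝ)` and is differentiable in `L^p(ℝ)` with derivative `-D q(t)`. -/
structure IsSolution (a b : ℝ) (νbar : Measure ℝ≥0) {p : ℝ≥0∞} [Fact (1 ≤ p)]
    (u : Lp 𝕜 p (volume : Measure ℝ)) (q : ℝ → Lp 𝕜 p (volume : Measure ℝ)) : Prop where
  continuousOn : ContinuousOn q (Ici 0)
  initial : q 0 = u
  equation : ∀ t : ℝ, 0 < t →
    ∃ w : Lp 𝕜 p (volume : Measure ℝ), IsLeftWeylDeriv a b νbar (q t) w ∧ HasDerivAt q (-w) t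

end Line

end

/-! ### Weak convergence of measures on `[0, ∞)` from convergence of Laplace transforms -/

section Laplace

/-! The measures `μ_t` are handled through their Laplace transforms. If the transforms of finite
measures on `[0, ∞)` converge pointwise on `[0, ∞)` to that of a finite measure, so do the integrals
of bounded continuous functions, even Banach-valued ones (`tendsto_integral_of_tendsto_laplace`).
For the orbits `s ↦ T_s u` of a contraction semigroup this yields the semigroup law and the strong
continuity of `Q_t u = ∫ T_s u μ_t(ds)`.

Phillips' formula (`isGeneratorValue_subordinate`) has the same source. The measures `t⁻¹ (1 -
e^{-s}) μ_t(ds)` have transforms `t⁻¹ (e^{-t f(r)} - e^{-t f(r+1)})`, which tend to `f(r+1) - f(r)`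
as `t → 0`, the transform of `b δ₀ + (1 - e^{-s}) νbar(ds)`; here `f(0) = f(0+) = a`. Testing
against `(T_s u - u) / (1 - e^{-s})`, extended by `A u` at `s = 0`, gives `b A u + ∫ (T_s u - u)
νbar(ds)`, and the mass `1 - e^{-ta}` lost by `μ_t` gives `-a u`.

For translations, `W^{1,p}` lies in the domain because `g(x+t) - g(x) = ∫_0^t g'(x+s) ds`. Fubini on
the region `s < z` turns `∫_0^R ν(s) g'(x+s) ds` into `a (g(x+R) - g(x)) + ∫ (g(x + min R z) - g(x))
νbar(dz)`; since `g` vanishes at `+∞`, letting `R → ∞` leaves Phillips' expression without its drift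
term. `Lp.integral_eval` passes between Bochner integrals in `L^p` and integrals at almost every
point.

`Q_t` commutes with differentiation, so it preserves `W^{1,p}` and its orbits there solve the
equation. For another solution `q` the function `s ↦ Q_{t-s} q(s)` is constant on `[0, t]`, which
gives uniqueness. -/

theorem integrable_of_continuous_of_bounded {B : Type*} [NormedAddCommGroup B]
    (m : Measure ℝ≥0) [IsFiniteMeasure m] {φ : ℝ≥0 → B}
    (hc : Continuous φ) {C : ℝ} (hb : ∀ s, ‖φ s‖ ≤ C) : Integrable φ m :=
  Integrable.of_bound hc.aestronglyMeasurable C (ae_of_all _ hb)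

theorem exp_neg_mul_le_one {l : ℝ} (hl : 0 ≤ l) (s : ℝ≥0) : Real.exp (-(l * (s : ℝ))) ≤ 1 :=
  Real.exp_le_one_iff.2 (by have := s.2; simp only [Left.neg_nonpos_iff]; positivity)

theorem integrable_exp_neg_mul (m : Measure ℝ≥0) [IsFiniteMeasure m] {l : ℝ} (hl : 0 ≤ l) :
    Integrable (fun s : ℝ≥0 => Real.exp (-(l * (s : ℝ)))) m :=
  integrable_of_continuous_of_bounded m (by fun_prop) (C := 1) fun s => by
    rw [Real.norm_eq_abs, abs_of_pos (Real.exp_pos _)]; exact exp_neg_mul_le_one hl s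

/-- The Laplace transform of a finite measure is continuous at `0`. -/
theorem tendsto_laplace_zero (m : Measure ℝ≥0) [IsFiniteMeasure m] :
    Tendsto (fun l : ℝ => ∫ s : ℝ≥0, Real.exp (-(l * (s : ℝ))) ∂m) (𝓝[>] 0)
      (𝓝 (∫ s : ℝ≥0, Real.exp (-(0 * (s : ℝ))) ∂m)) := by
  refine tendsto_integral_filter_of_dominated_convergence (fun _ => 1) ?_ ?_
    (integrable_const _) ?_
  · exact Eventually.of_forall fun l => Continuous.aestronglyMeasurable (by fun_prop)
  · filter_upwards [self_mem_nhdsWithin] with l hl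
    refine ae_of_all _ fun s => ?_
    rw [Real.norm_eq_abs, abs_of_pos (Real.exp_pos _)]
    exact exp_neg_mul_le_one (le_of_lt hl) s
  · refine ae_of_all _ fun s => tendsto_nhdsWithin_of_tendsto_nhds ?_
    exact Continuous.tendsto (f := fun l : ℝ => Real.exp (-(l * (s : ℝ)))) (by fun_prop) 0

variable {B : Type*} [NormedAddCommGroup B] [NormedSpace ℝ B]

variable {ι : Type*} {l : Filter ι} {m : ι → Measure ℝ≥0} {m₀ : Measure ℝ≥0}

/-- A three-epsilon argument. The error is dominated by a function `w` rather than a constant: the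
integrals of `w` converge too, and this replaces a separate tightness argument. -/
theorem tendsto_integral_of_approx {φ : ℝ≥0 → B} (hφ : ∀ i, Integrable φ (m i))
    (hφ₀ : Integrable φ m₀)
    (H : ∀ δ > 0, ∃ (ψ : ℝ≥0 → B) (w : ℝ≥0 → ℝ), (∀ i, Integrable ψ (m i)) ∧ Integrable ψ m₀ ∧
      (∀ i, Integrable w (m i)) ∧ Integrable w m₀ ∧ (∀ s, ‖φ s - ψ s‖ ≤ w s) ∧
      Tendsto (fun i => ∫ s, ψ s ∂m i) l (𝓝 (∫ s, ψ s ∂m₀)) ∧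
      Tendsto (fun i => ∫ s, w s ∂m i) l (𝓝 (∫ s, w s ∂m₀)) ∧ ∫ s, w s ∂m₀ < δ) :
    Tendsto (fun i => ∫ s, φ s ∂m i) l (𝓝 (∫ s, φ s ∂m₀)) := by
  rw [Metric.tendsto_nhds]
  intro ε hε
  obtain ⟨ψ, w, hψ, hψ₀, hw, hw₀, hle, htψ, htw, hlt⟩ := H (ε / 3) (by positivity)
  filter_upwards [Metric.tendsto_nhds.1 htψ (ε / 3) (by positivity),
    htw.eventually_lt_const hlt] with i h1 h2
  have key : ∀ μ : Measure ℝ≥0, Integrable φ μ → Integrable ψ μ → Integrable w μ →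
      dist (∫ s, φ s ∂μ) (∫ s, ψ s ∂μ) ≤ ∫ s, w s ∂μ := by
    intro μ h h' h''
    rw [dist_eq_norm, ← integral_sub h h']
    exact norm_integral_le_of_norm_le h'' (ae_of_all _ hle)
  have k1 := key _ (hφ i) (hψ i) (hw i)
  have k2 := key _ hφ₀ hψ₀ hw₀
  rw [dist_comm] at k2
  have := dist_triangle4 (∫ s, φ s ∂m i) (∫ s, ψ s ∂m i) (∫ s, ψ s ∂m₀) (∫ s, φ s ∂m₀)
  linarith

variable [∀ i, IsFiniteMeasure (m i)] [IsFiniteMeasure m₀]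

theorem tendsto_integral_polynomial_exp_neg
    (h : ∀ r : ℝ, 0 ≤ r → Tendsto (fun i => ∫ s : ℝ≥0, Real.exp (-(r * (s : ℝ))) ∂m i) l
      (𝓝 (∫ s : ℝ≥0, Real.exp (-(r * (s : ℝ))) ∂m₀))) (q : Polynomial ℝ) :
    Tendsto (fun i => ∫ s : ℝ≥0, q.eval (Real.exp (-(s : ℝ))) ∂m i) l
      (𝓝 (∫ s : ℝ≥0, q.eval (Real.exp (-(s : ℝ))) ∂m₀)) := by
  have key : ∀ (μ : Measure ℝ≥0) [IsFiniteMeasure μ],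
      ∫ s : ℝ≥0, q.eval (Real.exp (-(s : ℝ))) ∂μ =
        ∑ k ∈ Finset.range (q.natDegree + 1),
          q.coeff k * ∫ s : ℝ≥0, Real.exp (-((k : ℝ) * (s : ℝ))) ∂μ := by
    intro μ _
    simp_rw [Polynomial.eval_eq_sum_range, ← Real.exp_nat_mul, mul_neg]
    rw [integral_finsetSum]
    · simp_rw [integral_const_mul]
    · intro k _
      exact (integrable_exp_neg_mul μ k.cast_nonneg).const_mul _
  simp_rw [key]
  exact tendsto_finsetSum _ fun k _ => (h k k.cast_nonneg).const_mul _

/-- The substitution `x = e^{-s}` turns Laplace transforms at the integers into moments on `[0, 1]`.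
Bernstein polynomials approximate `F` uniformly and keep the values of `F` as coefficients, so
vector-valued `F` needs no extra work. -/
theorem tendsto_integral_comp_exp_neg [CompleteSpace B]
    (h : ∀ r : ℝ, 0 ≤ r → Tendsto (fun i => ∫ s : ℝ≥0, Real.exp (-(r * (s : ℝ))) ∂m i) l
      (𝓝 (∫ s : ℝ≥0, Real.exp (-(r * (s : ℝ))) ∂m₀)))
    (e : ℝ≥0 → unitInterval) (he : ∀ s, (e s : ℝ) = Real.exp (-(s : ℝ)))
    (F : C(unitInterval, B)) :
    Tendsto (fun i => ∫ s : ℝ≥0, F (e s) ∂m i) l (𝓝 (∫ s : ℝ≥0, F (e s) ∂m₀)) := by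
  have hec : Continuous e := by
    rw [Topology.IsEmbedding.subtypeVal.continuous_iff]
    have : (Subtype.val ∘ e) = fun s : ℝ≥0 => Real.exp (-(s : ℝ)) := funext he
    rw [this]; fun_prop
  have hint : ∀ (G : C(unitInterval, B)) (μ : Measure ℝ≥0) [IsFiniteMeasure μ],
      Integrable (fun s => G (e s)) μ := fun G μ _ =>
    integrable_of_continuous_of_bounded μ (by fun_prop) fun s => G.norm_coe_le_norm (e s)
  refine tendsto_integral_of_approx (fun i => hint F _) (hint F _) fun δ hδ => ?_
  -- Chosen so that the constant `η` has `m₀`-integral below `δ`; the `+ 1` covers `m₀ = 0`.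
  set η : ℝ := δ / (2 * (m₀.real univ + 1)) with hη
  have hm : 0 ≤ m₀.real univ := measureReal_nonneg
  have hη0 : 0 < η := by positivity
  obtain ⟨n, hn⟩ := (Metric.tendsto_nhds.1 (bernsteinApproximation_uniform F) η hη0).exists
  refine ⟨fun s => bernsteinApproximation n F (e s), fun _ => η, fun i => hint _ _, hint _ _,
    fun i => integrable_const _, integrable_const _, fun s => ?_, ?_, ?_, ?_⟩
  · rw [← dist_eq_norm, dist_comm]
    exact (ContinuousMap.dist_apply_le_dist (e s)).trans hn.le
  · have key : ∀ (μ : Measure ℝ≥0) [IsFiniteMeasure μ],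
        ∫ s, bernsteinApproximation n F (e s) ∂μ = ∑ k : Fin (n + 1),
          (∫ s : ℝ≥0, (bernsteinPolynomial ℝ n k).eval (Real.exp (-(s : ℝ))) ∂μ) •
            F (bernstein.z k) := by
      intro μ _
      simp_rw [bernsteinApproximation.apply]
      rw [integral_finsetSum]
      · refine Finset.sum_congr rfl fun k _ => ?_
        rw [← integral_smul_const]
        refine integral_congr_ae (ae_of_all _ fun s => ?_)
        simp [bernstein, he]
      · intro k _
        exact integrable_of_continuous_of_bounded μ (by fun_prop)
          (C := ‖bernstein n k‖ * ‖F (bernstein.z k)‖) fun s => by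
            rw [norm_smul]; gcongr; exact ContinuousMap.norm_coe_le_norm _ _
    simp_rw [key]
    exact tendsto_finsetSum _ fun k _ =>
      (tendsto_integral_polynomial_exp_neg h _).smul_const _
  · have := (h 0 le_rfl).mul_const η
    simpa [neg_zero] using this
  · rw [integral_const, smul_eq_mul, hη]
    rw [mul_div_assoc', div_lt_iff₀ (by positivity)]
    nlinarith

/-- If the Laplace transforms of finite measures on `[0, ∞)` converge on `[0, ∞)` to that of a
finite measure, then so do the integrals of bounded continuous functions. -/
theorem tendsto_integral_of_tendsto_laplace [CompleteSpace B]
    (h : ∀ r : ℝ, 0 ≤ r → Tendsto (fun i => ∫ s : ℝ≥0, Real.exp (-(r * (s : ℝ))) ∂m i) l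
      (𝓝 (∫ s : ℝ≥0, Real.exp (-(r * (s : ℝ))) ∂m₀)))
    {φ : ℝ≥0 → B} (hc : Continuous φ) {C : ℝ} (hb : ∀ s, ‖φ s‖ ≤ C) :
    Tendsto (fun i => ∫ s, φ s ∂m i) l (𝓝 (∫ s, φ s ∂m₀)) := by
  have hC : 0 ≤ C := (norm_nonneg _).trans (hb 0)
  have hφ : ∀ (μ : Measure ℝ≥0) [IsFiniteMeasure μ], Integrable φ μ := fun μ _ =>
    integrable_of_continuous_of_bounded μ hc hb
  refine tendsto_integral_of_approx (fun i => hφ _) (hφ _) fun δ hδ => ?_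
  -- The error weight is `C (1 - e^{-εs})`. With `1` written as `e^{-0·s}`, its integral is a
  -- difference of two Laplace transforms.
  have hw : ∀ ε : ℝ, 0 ≤ ε → ∀ (μ : Measure ℝ≥0) [IsFiniteMeasure μ],
      Integrable (fun s : ℝ≥0 => C * (Real.exp (-(0 * (s : ℝ))) - Real.exp (-(ε * (s : ℝ))))) μ ∧
      ∫ s : ℝ≥0, C * (Real.exp (-(0 * (s : ℝ))) - Real.exp (-(ε * (s : ℝ)))) ∂μ =
        C * (∫ s : ℝ≥0, Real.exp (-(0 * (s : ℝ))) ∂μ - ∫ s : ℝ≥0, Real.exp (-(ε * (s : ℝ))) ∂μ) := by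
    intro ε hε μ _
    have h0 := integrable_exp_neg_mul μ le_rfl
    have h1 := integrable_exp_neg_mul μ hε
    exact ⟨(h0.sub h1).const_mul _, by rw [integral_const_mul, integral_sub h0 h1]⟩
  have hlim : Tendsto (fun ε : ℝ => C * (∫ s : ℝ≥0, Real.exp (-(0 * (s : ℝ))) ∂m₀ -
      ∫ s : ℝ≥0, Real.exp (-(ε * (s : ℝ))) ∂m₀)) (𝓝[>] 0) (𝓝 0) := by
    have := ((tendsto_laplace_zero m₀).const_sub (∫ s : ℝ≥0, Real.exp (-(0 * (s : ℝ))) ∂m₀)).const_mul C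
    simpa only [sub_self, mul_zero] using this
  obtain ⟨ε, hεδ, hε⟩ := ((hlim.eventually_lt_const hδ).and self_mem_nhdsWithin).exists
  replace hε : 0 < ε := hε
  let e : ℝ≥0 → unitInterval := fun s => ⟨Real.exp (-(s : ℝ)), (Real.exp_pos _).le,
    by simp⟩
  -- Damping by `e^{-εs} = x^ε` makes `φ`, as a function of `x = e^{-s}`, continuous up to `x = 0`,
  -- that is `s = ∞`, where it vanishes.
  let F : C(unitInterval, B) :=
    { toFun := fun x => ((x : ℝ) ^ ε) • φ (Real.toNNReal (-Real.log x))
      continuous_toFun := by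
        rw [continuous_iff_continuousAt]
        intro x
        have hpow : ContinuousAt (fun x : unitInterval => (x : ℝ) ^ ε) x :=
          (Real.continuousAt_rpow_const _ _ (Or.inr hε.le)).comp continuous_subtype_val.continuousAt
        by_cases hx : (x : ℝ) = 0
        · have h0 : ((x : ℝ) ^ ε) • φ (Real.toNNReal (-Real.log x)) = 0 := by
            rw [hx, Real.zero_rpow hε.ne', zero_smul]
          change Tendsto _ _ (𝓝 (((x : ℝ) ^ ε) • φ (Real.toNNReal (-Real.log x))))
          rw [h0]
          have hp : Tendsto (fun x : unitInterval => (x : ℝ) ^ ε * C) (𝓝 x) (𝓝 0) := by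
            have : Tendsto (fun x : unitInterval => (x : ℝ) ^ ε * C) (𝓝 x)
                (𝓝 ((x : ℝ) ^ ε * C)) := hpow.tendsto.mul_const C
            rwa [hx, Real.zero_rpow hε.ne', zero_mul] at this
          refine squeeze_zero_norm (fun y => ?_) hp
          have hy : 0 ≤ (y : ℝ) ^ ε := Real.rpow_nonneg y.2.1 _
          rw [norm_smul, Real.norm_of_nonneg hy]
          exact mul_le_mul_of_nonneg_left (hb _) hy
        · refine hpow.smul (hc.continuousAt.comp ?_)
          refine continuous_real_toNNReal.continuousAt.comp (ContinuousAt.neg ?_)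
          exact (Real.continuousAt_log hx).comp continuous_subtype_val.continuousAt }
  have hF : ∀ s, F (e s) = Real.exp (-(ε * (s : ℝ))) • φ s := by
    intro s
    change (Real.exp (-(s : ℝ)) ^ ε) • φ (Real.toNNReal (-Real.log (Real.exp (-(s : ℝ))))) = _
    rw [Real.log_exp, neg_neg, Real.toNNReal_coe, ← Real.exp_mul]
    congr 2; ring
  have hFi : ∀ (μ : Measure ℝ≥0) [IsFiniteMeasure μ], Integrable (fun s => F (e s)) μ := by
    intro μ _
    refine integrable_of_continuous_of_bounded μ ?_ fun s => F.norm_coe_le_norm (e s)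
    simp_rw [hF]; fun_prop
  refine ⟨fun s => F (e s), _, fun i => hFi _, hFi _, fun i => (hw ε hε.le (m i)).1,
    (hw ε hε.le m₀).1, fun s => ?_, tendsto_integral_comp_exp_neg h e (fun _ => rfl) F, ?_, ?_⟩
  · have h1 := exp_neg_mul_le_one hε.le s
    simp only [hF]
    rw [show φ s - Real.exp (-(ε * (s : ℝ))) • φ s =
      (1 - Real.exp (-(ε * (s : ℝ)))) • φ s by rw [sub_smul, one_smul], norm_smul,
      Real.norm_of_nonneg (by linarith), mul_comm]
    simp only [zero_mul, neg_zero, Real.exp_zero]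
    exact mul_le_mul_of_nonneg_right (hb s) (by linarith)
  · simp_rw [fun i => (hw ε hε.le (m i)).2, (hw ε hε.le m₀).2]
    exact ((h 0 le_rfl).sub (h ε hε.le)).const_mul C
  · rw [(hw ε hε.le m₀).2]; exact hεδ

end Laplace

/-! ### Absolutely continuous functions and `W^{1,p}(ℝ)` -/

section AbsCont

theorem AbsolutelyContinuousOnInterval.of_dist_le {X Y : Type*} [PseudoMetricSpace X]
    [PseudoMetricSpace Y] {f : ℝ → X} {g : ℝ → Y} {a b : ℝ}
    (hg : AbsolutelyContinuousOnInterval g a b)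
    (h : ∀ x ∈ uIcc a b, ∀ y ∈ uIcc a b, dist (f x) (f y) ≤ dist (g x) (g y)) :
    AbsolutelyContinuousOnInterval f a b := by
  refine squeeze_zero' (Eventually.of_forall fun E => Finset.sum_nonneg fun _ _ => dist_nonneg)
    ?_ hg
  have : ∀ᶠ E : ℕ × (ℕ → ℝ × ℝ) in AbsolutelyContinuousOnInterval.totalLengthFilter ⊓
      𝓟 (AbsolutelyContinuousOnInterval.disjWithin a b),
      E ∈ AbsolutelyContinuousOnInterval.disjWithin a b :=
    eventually_inf_principal.mpr (by simp)
  filter_upwards [this] with E hE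
  exact Finset.sum_le_sum fun i hi => h _ (hE.1 i hi).1 _ (hE.1 i hi).2

theorem MeasureTheory.LocallyIntegrable.intervalIntegrable_of_real {E : Type*} [NormedAddCommGroup E]
    {w : ℝ → E} (hw : LocallyIntegrable w volume) (a b : ℝ) : IntervalIntegrable w volume a b :=
  intervalIntegrable_iff.mpr <|
    (hw.integrableOn_isCompact isCompact_uIcc).mono_set uIoc_subset_uIcc

/-- The increments of `G` are bounded by those of the real primitive of `‖w‖`. -/
theorem absolutelyContinuousOnInterval_of_sub_eq_integral {E : Type*} [NormedAddCommGroup E]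
    [NormedSpace ℝ E] {G w : ℝ → E} (hw : LocallyIntegrable w volume)
    (h : ∀ x y, G y - G x = ∫ t in x..y, w t) (a b : ℝ) :
    AbsolutelyContinuousOnInterval G a b := by
  have hwn : LocallyIntegrable (fun x => ‖w x‖) volume := fun x => (hw x).norm
  have hn := (hwn.intervalIntegrable_of_real a b).absolutelyContinuousOnInterval_intervalIntegral
    (c := a) (by simp)
  refine hn.of_dist_le fun x _ y _ => ?_
  rw [dist_comm, dist_comm (∫ v in a..x, ‖w v‖), dist_eq_norm, dist_eq_norm, h,
    intervalIntegral.integral_interval_sub_left (hwn.intervalIntegrable_of_real _ _)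
      (hwn.intervalIntegrable_of_real _ _), Real.norm_eq_abs]
  exact intervalIntegral.norm_integral_le_abs_integral_norm

variable {𝕜 : Type*} [RCLike 𝕜]

theorem AbsolutelyContinuousOnInterval.ae_differentiableAt_rclike {g : ℝ → 𝕜} {a b : ℝ}
    (hg : AbsolutelyContinuousOnInterval g a b) :
    ∀ᵐ x : ℝ, x ∈ uIcc a b → DifferentiableAt ℝ g x := by
  have hre : AbsolutelyContinuousOnInterval (fun x => RCLike.re (g x)) a b :=
    hg.of_dist_le fun x _ y _ => by
      rw [dist_eq_norm, dist_eq_norm, ← map_sub]; exact RCLike.norm_re_le_norm _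
  have him : AbsolutelyContinuousOnInterval (fun x => RCLike.im (g x)) a b :=
    hg.of_dist_le fun x _ y _ => by
      rw [dist_eq_norm, dist_eq_norm, ← map_sub]; exact RCLike.norm_im_le_norm _
  filter_upwards [hre.ae_differentiableAt, him.ae_differentiableAt] with x h1 h2 hx
  have : g = fun x => (RCLike.ofRealCLM (K := 𝕜)) (RCLike.re (g x)) +
      (RCLike.ofRealCLM (K := 𝕜)) (RCLike.im (g x)) * (RCLike.I : 𝕜) := by
    ext x; exact (RCLike.re_add_im (g x)).symm
  rw [this]
  exact ((RCLike.ofRealCLM (K := 𝕜)).differentiableAt.comp x (h1 hx)).add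
    (((RCLike.ofRealCLM (K := 𝕜)).differentiableAt.comp x (h2 hx)).mul_const _)

namespace MemW1p

variable {p : ℝ≥0∞} {g : ℝ → 𝕜}

theorem continuous (hg : MemW1p p g) : Continuous g := by
  rw [continuous_iff_continuousAt]
  intro x
  refine (hg.absCont (x - 1) (x + 1)).continuousOn.continuousAt ?_
  rw [uIcc_of_le (by linarith)]
  exact Icc_mem_nhds (by linarith) (by linarith)

theorem ae_differentiableAt (hg : MemW1p p g) : ∀ᵐ x : ℝ, DifferentiableAt ℝ g x := by
  have : ∀ᵐ x : ℝ, ∀ n : ℕ, x ∈ uIcc (-(n : ℝ)) n → DifferentiableAt ℝ g x :=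
    ae_all_iff.2 fun n => (hg.absCont _ _).ae_differentiableAt_rclike
  filter_upwards [this] with x hx
  obtain ⟨n, hn⟩ := exists_nat_ge |x|
  refine hx n ?_
  rw [uIcc_of_le (by linarith [abs_nonneg x])]
  exact abs_le.1 hn

theorem locallyIntegrable_deriv (hp : 1 ≤ p) (hg : MemW1p p g) :
    LocallyIntegrable (deriv g) volume := hg.memLp_deriv.locallyIntegrable hp

/-- By Lebesgue differentiation, `g` minus the primitive of `deriv g` is absolutely continuous with
derivative zero almost everywhere, hence constant. -/
theorem integral_deriv (hp : 1 ≤ p) (hg : MemW1p p g) (a b : ℝ) :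
    ∫ x in a..b, deriv g x = g b - g a := by
  have hl := hg.locallyIntegrable_deriv hp
  have h1 : AbsolutelyContinuousOnInterval (fun x => ∫ t in a..x, deriv g t) a b :=
    absolutelyContinuousOnInterval_of_sub_eq_integral hl (fun x y =>
      intervalIntegral.integral_interval_sub_left (hl.intervalIntegrable_of_real _ _)
        (hl.intervalIntegrable_of_real _ _)) a b
  obtain ⟨C, hC⟩ := ((hg.absCont a b).sub h1).const_of_ae_hasDerivAt_zero (by
    filter_upwards [hg.ae_differentiableAt, LocallyIntegrable.ae_hasDerivAt_integral hl] with x hx hx' _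
    convert hx.hasDerivAt.sub (hx' a) using 1
    rw [sub_self])
  have ha := hC a left_mem_uIcc
  have hb := hC b right_mem_uIcc
  simp only [Pi.sub_apply, intervalIntegral.integral_same, sub_zero] at ha hb
  rw [ha, ← hb]; abel

theorem of_sub_eq_integral (hp : 1 ≤ p) {w : ℝ → 𝕜} (hg : MemLp g p volume)
    (hw : MemLp w p volume) (h : ∀ x y, g y - g x = ∫ t in x..y, w t) :
    MemW1p p g ∧ deriv g =ᵐ[volume] w := by
  have hl := hw.locallyIntegrable hp
  have hd : deriv g =ᵐ[volume] w := by
    filter_upwards [LocallyIntegrable.ae_hasDerivAt_integral hl] with x hx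
    have : g = fun y => g 0 + ∫ t in (0 : ℝ)..y, w t := by ext y; rw [← h]; abel
    rw [this]
    exact ((hx 0).const_add (g 0)).deriv
  exact ⟨⟨hg, absolutelyContinuousOnInterval_of_sub_eq_integral hl h, hw.ae_eq hd.symm⟩, hd⟩

/-- Averaging `g x = g y - ∫_x^y g'` over `y` in the unit interval to the right of `x`. Only local
norms occur on the right, so the estimate gives both boundedness and decay at `+∞`. -/
theorem enorm_le_lintegral (hp : 1 ≤ p) (hg : MemW1p p g) (x : ℝ) :
    ‖g x‖ₑ ≤ (∫⁻ y in Ioc x (x + 1), ‖g y‖ₑ) + ∫⁻ y in Ioc x (x + 1), ‖deriv g y‖ₑ := by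
  have key : ∀ y ∈ Ioc x (x + 1), ‖g x‖ₑ ≤ ‖g y‖ₑ + ∫⁻ y in Ioc x (x + 1), ‖deriv g y‖ₑ := by
    intro y hy
    have h1 : g x = g y - ∫ t in Ioc x y, deriv g t := by
      rw [← intervalIntegral.integral_of_le hy.1.le, hg.integral_deriv hp]; abel
    rw [h1]
    refine (enorm_sub_le).trans ?_
    gcongr
    refine (enorm_integral_le_lintegral_enorm _).trans ?_
    exact lintegral_mono_set (Ioc_subset_Ioc_right hy.2)
  calc ‖g x‖ₑ = ∫⁻ y in Ioc x (x + 1), ‖g x‖ₑ := by simp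
    _ ≤ ∫⁻ y in Ioc x (x + 1), (‖g y‖ₑ + ∫⁻ y in Ioc x (x + 1), ‖deriv g y‖ₑ) :=
        setLIntegral_mono' measurableSet_Ioc key
    _ = _ := by
        rw [lintegral_add_left hg.continuous.measurable.enorm]; simp

theorem lintegral_enorm_Ioc_le {E : Type*} [NormedAddCommGroup E] {p : ℝ≥0∞} (hp : 1 ≤ p)
    {g : ℝ → E} (hg : AEStronglyMeasurable g volume) (x : ℝ) :
    ∫⁻ y in Ioc x (x + 1), ‖g y‖ₑ ≤ eLpNorm g p (volume.restrict (Ioc x (x + 1))) := by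
  have : IsProbabilityMeasure ((volume : Measure ℝ).restrict (Ioc x (x + 1))) := ⟨by simp⟩
  rw [← eLpNorm_one_eq_lintegral_enorm]
  exact eLpNorm_le_eLpNorm_of_exponent_le hp hg.restrict

theorem tendsto_eLpNorm_Ioc {E : Type*} [NormedAddCommGroup E] {p : ℝ≥0∞} (hp : 1 ≤ p)
    (hp' : p ≠ ∞) {g : ℝ → E} (hg : MemLp g p volume) :
    Tendsto (fun x : ℝ => eLpNorm g p (volume.restrict (Ioc x (x + 1)))) atTop (𝓝 0) := by
  have hp0 : p ≠ 0 := (zero_lt_one.trans_le hp).ne'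
  have hpr : 0 < p.toReal := ENNReal.toReal_pos hp0 hp'
  simp_rw [eLpNorm_eq_lintegral_rpow_enorm_toReal hp0 hp']
  have hfin := lintegral_rpow_enorm_lt_top_of_eLpNorm_lt_top hp0 hp' hg.2
  have h1 : Tendsto (fun x : ℝ => ∫⁻ y, (Ioc x (x + 1)).indicator (fun y => ‖g y‖ₑ ^ p.toReal) y)
      atTop (𝓝 (∫⁻ _ : ℝ, 0)) := by
    refine tendsto_lintegral_filter_of_dominated_convergence' (fun y => ‖g y‖ₑ ^ p.toReal)
      (Eventually.of_forall fun x => ?_) (Eventually.of_forall fun x => ae_of_all _ fun y => ?_)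
      hfin.ne (ae_of_all _ fun y => ?_)
    · exact (hg.1.enorm.pow_const _).indicator measurableSet_Ioc
    · exact indicator_le_self _ _ _
    · refine tendsto_const_nhds.congr' ?_
      filter_upwards [eventually_ge_atTop y] with x hx
      rw [indicator_of_notMem]
      exact fun h => absurd h.1 (not_lt.2 hx)
  simp only [lintegral_zero] at h1
  have h2 := h1.ennrpow_const (1 / p.toReal)
  rw [ENNReal.zero_rpow_of_pos (by positivity)] at h2
  refine h2.congr fun x => ?_
  rw [lintegral_indicator measurableSet_Ioc]

theorem exists_bound (hp : 1 ≤ p) (hg : MemW1p p g) : ∃ C : ℝ, ∀ x, ‖g x‖ ≤ C := by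
  have hfin : eLpNorm g p volume + eLpNorm (deriv g) p volume ≠ ∞ :=
    ENNReal.add_ne_top.2 ⟨hg.memLp.2.ne, hg.memLp_deriv.2.ne⟩
  refine ⟨(eLpNorm g p volume + eLpNorm (deriv g) p volume).toReal, fun x => ?_⟩
  rw [← toReal_enorm]
  refine ENNReal.toReal_mono hfin ((hg.enorm_le_lintegral hp x).trans (add_le_add ?_ ?_))
  · exact (lintegral_enorm_Ioc_le hp hg.memLp.1 x).trans (eLpNorm_restrict_le _ _ _ _)
  · exact (lintegral_enorm_Ioc_le hp hg.memLp_deriv.1 x).trans (eLpNorm_restrict_le _ _ _ _)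

theorem tendsto_zero (hp : 1 ≤ p) (hp' : p ≠ ∞) (hg : MemW1p p g) :
    Tendsto g atTop (𝓝 0) := by
  rw [tendsto_zero_iff_enorm_tendsto_zero]
  have := (tendsto_eLpNorm_Ioc hp hp' hg.memLp).add (tendsto_eLpNorm_Ioc hp hp' hg.memLp_deriv)
  rw [add_zero] at this
  refine tendsto_of_tendsto_of_tendsto_of_le_of_le tendsto_const_nhds this (fun _ => zero_le)
    fun x => (hg.enorm_le_lintegral hp x).trans ?_
  exact add_le_add (lintegral_enorm_Ioc_le hp hg.memLp.1 x)
    (lintegral_enorm_Ioc_le hp hg.memLp_deriv.1 x)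

end MemW1p

end AbsCont

/-! ### Pointwise evaluation of Bochner integrals in `L^p` -/

section Evaluation

variable {X Y E : Type*} [MeasurableSpace X] [MeasurableSpace Y] [NormedAddCommGroup E]
  {μ : Measure X} {ν : Measure Y} {p : ℝ≥0∞}

theorem integrableOn_lp (hp : 1 ≤ p) {A : Set Y} (hA' : ν A < ∞)
    (u : Lp E p ν) : IntegrableOn u A ν := by
  have : IsFiniteMeasure (ν.restrict A) := ⟨by simpa using hA'⟩
  exact memLp_one_iff_integrable.1 (((Lp.memLp u).restrict A).mono_exponent hp)

/-- Hölder's inequality on a set of finite measure. -/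
theorem exists_setIntegral_norm_le (hp : 1 ≤ p) {A : Set Y} (hA' : ν A < ∞) :
    ∃ C : ℝ, ∀ u : Lp E p ν, ∫ y in A, ‖u y‖ ∂ν ≤ C * ‖u‖ := by
  have : IsFiniteMeasure (ν.restrict A) := ⟨by simpa using hA'⟩
  set c := (ν.restrict A) univ ^ (1 / (1 : ℝ≥0∞).toReal - 1 / p.toReal) with hc
  have hcf : c ≠ ∞ := by
    -- Here `p.toReal = 0` and `1 / 0 = 0`, so the exponent is `1`, as it should be.
    by_cases h0 : p = ∞
    · rw [hc, h0]; simpa using hA'.ne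
    refine ENNReal.rpow_ne_top_of_nonneg ?_ (measure_ne_top _ _)
    have h1 : 1 ≤ p.toReal := by
      rw [← ENNReal.toReal_one]; exact ENNReal.toReal_mono h0 hp
    simp only [ENNReal.toReal_one, div_one, sub_nonneg]
    exact div_le_one_of_le₀ h1 (by linarith)
  refine ⟨c.toReal, fun u => ?_⟩
  rw [integral_norm_eq_lintegral_enorm (Lp.aestronglyMeasurable u).restrict, Lp.norm_def,
    mul_comm, ← ENNReal.toReal_mul]
  refine ENNReal.toReal_mono (ENNReal.mul_ne_top (Lp.eLpNorm_ne_top u) hcf) ?_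
  rw [← eLpNorm_one_eq_lintegral_enorm]
  refine (eLpNorm_le_eLpNorm_mul_rpow_measure_univ hp
    (Lp.aestronglyMeasurable u).restrict).trans ?_
  exact mul_le_mul_left (eLpNorm_restrict_le _ _ _ _) _

/-- Integration over a set of finite measure, as a continuous linear map on `L^p`. -/
theorem exists_setIntegral_clm [NormedSpace ℝ E] [Fact (1 ≤ p)] {A : Set Y} (hA' : ν A < ∞) :
    ∃ J : Lp E p ν →L[ℝ] E, ∀ u : Lp E p ν, J u = ∫ y in A, u y ∂ν := by
  have hp : 1 ≤ p := Fact.out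
  obtain ⟨C, hC⟩ := exists_setIntegral_norm_le (E := E) hp hA'
  refine ⟨LinearMap.mkContinuous
    { toFun := fun u => ∫ y in A, u y ∂ν
      map_add' := fun u v => ?_
      map_smul' := fun c u => ?_ } C fun u => ?_, fun u => rfl⟩
  · rw [← integral_add (integrableOn_lp hp hA' u) (integrableOn_lp hp hA' v)]
    exact integral_congr_ae (ae_restrict_of_ae (Lp.coeFn_add u v))
  · rw [RingHom.id_apply, ← integral_smul]
    exact integral_congr_ae (ae_restrict_of_ae (Lp.coeFn_smul c u))
  · exact (norm_integral_le_integral_norm _).trans (hC u)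

/-- The hypothesis for Fubini: the `L¹` norm over `A` of each section is at most a constant times
`‖F s‖`, which is integrable in `s`. -/
theorem Lp.integrable_prod_restrict [SFinite μ] [SFinite ν] [hp : Fact (1 ≤ p)]
    {F : X → Lp E p ν} (hF : Integrable F μ) {k : X → Y → E}
    (hk : StronglyMeasurable (Function.uncurry k)) (hFk : ∀ᵐ s ∂μ, F s =ᵐ[ν] k s)
    {A : Set Y} (hA' : ν A < ∞) :
    Integrable (Function.uncurry k) (μ.prod (ν.restrict A)) := by
  rw [integrable_prod_iff hk.aestronglyMeasurable]
  refine ⟨?_, ?_⟩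
  · filter_upwards [hFk] with s hs
    exact (integrableOn_lp hp.out hA' (F s)).congr (ae_restrict_of_ae hs)
  · obtain ⟨C, hC⟩ := exists_setIntegral_norm_le (E := E) hp.out hA'
    refine (hF.norm.const_mul C).mono' ?_ ?_
    · exact (hk.norm.integral_prod_right (f := fun s y => ‖k s y‖)).aestronglyMeasurable
    · filter_upwards [hFk] with s hs
      rw [Real.norm_of_nonneg (integral_nonneg fun _ => norm_nonneg _)]
      refine le_trans (le_of_eq (integral_congr_ae ?_)) (hC (F s))
      filter_upwards [ae_restrict_of_ae hs] with y hy
      rw [hy]; rfl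

/-- A Bochner integral in `L^p` may be computed pointwise. -/
theorem Lp.integral_eval [SFinite μ] [SigmaFinite ν] [NormedSpace ℝ E] [CompleteSpace E]
    [hp : Fact (1 ≤ p)] {F : X → Lp E p ν} (hF : Integrable F μ) {k : X → Y → E}
    (hk : StronglyMeasurable (Function.uncurry k)) (hFk : ∀ᵐ s ∂μ, F s =ᵐ[ν] k s) :
    (∀ᵐ y ∂ν, Integrable (fun s => k s y) μ) ∧
      (∫ s, F s ∂μ : Lp E p ν) =ᵐ[ν] fun y => ∫ s, k s y ∂μ := by
  have hI := fun (A : Set Y) (hA' : ν A < ∞) =>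
    Lp.integrable_prod_restrict hF hk hFk hA'
  refine ⟨?_, ?_⟩
  · refine ae_of_forall_measure_lt_top_ae_restrict _ fun A hA hA' => ?_
    exact (hI A hA').prod_left_ae
  · refine ae_eq_of_forall_setIntegral_eq_of_sigmaFinite
      (fun A _ hA' => integrableOn_lp hp.out hA' _)
      (fun A _ hA' => (hI A hA').integral_prod_right) fun A hA hA' => ?_
    -- Integration over `A` is a continuous functional on `L^p`, so it commutes with the Bochner
    -- integral; Fubini does the same for `k`, and such sets `A` determine a function almost
    -- everywhere.
    obtain ⟨J, hJ⟩ := exists_setIntegral_clm (E := E) (p := p) (ν := ν) hA'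
    rw [← hJ, ← J.integral_comp_comm hF, ← integral_integral_swap (hI A hA')]
    refine integral_congr_ae ?_
    filter_upwards [hFk] with s hs
    rw [hJ]
    exact integral_congr_ae (ae_restrict_of_ae hs)

end Evaluation

/-! ### Translations -/

section Semigroup

variable {𝕜 B : Type*} [RCLike 𝕜] [NormedAddCommGroup B] [NormedSpace ℝ B] [NormedSpace 𝕜 B]

theorem tendsto_coe_nhdsGT_zero : Tendsto ((↑) : ℝ≥0 → ℝ) (𝓝[>] 0) (𝓝[>] 0) :=
  tendsto_nhdsWithin_iff.2 ⟨tendsto_nhdsWithin_of_tendsto_nhds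
    (NNReal.continuous_coe.tendsto' 0 0 rfl), by
      filter_upwards [self_mem_nhdsWithin] with x hx using hx⟩

theorem isGeneratorValue_of_integral [CompleteSpace B] {T : ℝ≥0 → B →L[𝕜] B} {u v : B}
    (h0 : T 0 v = v) (hc : Continuous fun s => T s v)
    (h : ∀ t : ℝ≥0, T t u - u = ∫ s in (0 : ℝ)..t, T s.toNNReal v) : IsGeneratorValue T u v := by
  have hc' : Continuous fun s : ℝ => T s.toNNReal v := hc.comp continuous_real_toNNReal
  have hd := (hc'.integral_hasStrictDerivAt 0 0).hasDerivAt.tendsto_slope_zero_right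
  refine ((hd.comp tendsto_coe_nhdsGT_zero).congr fun t => ?_).trans_eq ?_
  · simp [h]
  · simp [h0]

end Semigroup

section Translation

variable {𝕜 : Type*} [RCLike 𝕜] {p : ℝ≥0∞} [hp1 : Fact (1 ≤ p)]

theorem ae_comp_add_right {P : ℝ → Prop} (h : ∀ᵐ x : ℝ, P x) (s : ℝ) : ∀ᵐ x : ℝ, P (x + s) :=
  (measurePreserving_add_right (volume : Measure ℝ) s).quasiMeasurePreserving.ae h

theorem leftTranslation_coeFn (s : ℝ≥0) (u : Lp 𝕜 p (volume : Measure ℝ)) {g : ℝ → 𝕜}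
    (hg : u =ᵐ[volume] g) :
    leftTranslation 𝕜 p s u =ᵐ[volume] fun x => g (x + (s : ℝ)) := by
  have h := Lp.coeFn_compMeasurePreserving u
    (measurePreserving_add_right (volume : Measure ℝ) (s : ℝ))
  filter_upwards [h, ae_comp_add_right hg (s : ℝ)] with x hx hx'
  exact hx.trans hx'

theorem norm_leftTranslation (s : ℝ≥0) (u : Lp 𝕜 p (volume : Measure ℝ)) :
    ‖leftTranslation 𝕜 p s u‖ = ‖u‖ :=
  (Lp.compMeasurePreservingₗᵢ 𝕜 (fun x : ℝ => x + (s : ℝ))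
    (measurePreserving_add_right (volume : Measure ℝ) (s : ℝ))).norm_map u

theorem continuous_leftTranslation (hp : p ≠ ∞) (u : Lp 𝕜 p (volume : Measure ℝ)) :
    Continuous fun s : ℝ≥0 => leftTranslation 𝕜 p s u :=
  Continuous.compMeasurePreservingLp (f := fun _ : ℝ≥0 => u)
    (g := fun s : ℝ≥0 => ⟨fun x : ℝ => x + (s : ℝ), by fun_prop⟩) continuous_const
    (ContinuousMap.continuous_of_continuous_uncurry _ (by
      simp only [Function.uncurry_def, ContinuousMap.coe_mk]; fun_prop))
    (fun s => measurePreserving_add_right (volume : Measure ℝ) (s : ℝ)) hp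

theorem isC0Semigroup_leftTranslation (hp : p ≠ ∞) : IsC0Semigroup (leftTranslation 𝕜 p) := by
  have h0 : leftTranslation 𝕜 p 0 = ContinuousLinearMap.id 𝕜 _ := by
    ext1 u
    refine Lp.ext ((leftTranslation_coeFn 0 u EventuallyEq.rfl).trans ?_)
    simp
  refine ⟨h0, fun s t => ?_, fun u => ?_⟩
  · ext1 u
    refine Lp.ext ((leftTranslation_coeFn _ u EventuallyEq.rfl).trans ?_)
    refine (EventuallyEq.trans ?_ (leftTranslation_coeFn s _
      (leftTranslation_coeFn t u EventuallyEq.rfl)).symm)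
    refine ae_of_all _ fun x => ?_
    simp [add_assoc]
  · have := (continuous_leftTranslation (𝕜 := 𝕜) hp u).tendsto 0
    rwa [h0] at this

theorem HasSpaceDeriv.leftTranslation_sub (hp : p ≠ ∞) {u du : Lp 𝕜 p (volume : Measure ℝ)}
    (h : HasSpaceDeriv u du) (t : ℝ≥0) :
    leftTranslation 𝕜 p t u - u = ∫ s in (0 : ℝ)..t, leftTranslation 𝕜 p s.toNNReal du := by
  obtain ⟨g, hg, hu, hdu⟩ := h
  have hc : Continuous fun s : ℝ => leftTranslation 𝕜 p s.toNNReal du :=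
    (continuous_leftTranslation hp du).comp continuous_real_toNNReal
  have hF : IntegrableOn (fun s : ℝ => leftTranslation 𝕜 p s.toNNReal du) (Ioc 0 (t : ℝ)) volume :=
    hc.integrableOn_Ioc
  have hk : StronglyMeasurable (Function.uncurry fun (s x : ℝ) => deriv g (x + s)) :=
    (stronglyMeasurable_deriv g).comp_measurable (by fun_prop)
  have hev := (Lp.integral_eval hF hk (by
    filter_upwards [ae_restrict_mem measurableSet_Ioc] with s hs
    have := leftTranslation_coeFn s.toNNReal du hdu
    rwa [Real.coe_toNNReal s hs.1.le] at this)).2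
  rw [intervalIntegral.integral_of_le t.coe_nonneg]
  refine Lp.ext (EventuallyEq.trans ?_ hev.symm)
  filter_upwards [Lp.coeFn_sub (leftTranslation 𝕜 p t u) u, leftTranslation_coeFn t u hu, hu]
    with x h1 h2 h3
  rw [h1, Pi.sub_apply, h2, h3, ← intervalIntegral.integral_of_le t.coe_nonneg,
    intervalIntegral.integral_comp_add_left (fun y => deriv g y) x, hg.integral_deriv hp1.out,
    add_zero]

theorem HasSpaceDeriv.isGeneratorValue (hp : p ≠ ∞) {u du : Lp 𝕜 p (volume : Measure ℝ)}
    (h : HasSpaceDeriv u du) : IsGeneratorValue (leftTranslation 𝕜 p) u du :=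
  isGeneratorValue_of_integral (by rw [(isC0Semigroup_leftTranslation hp).zero]; rfl)
    (continuous_leftTranslation hp du) (h.leftTranslation_sub hp)

end Translation

/-! ### Bernstein functions and their Lévy measures -/

section Bernstein

variable {f : ℝ → ℝ} {a b : ℝ} {νbar : Measure ℝ≥0}

/-- The Lévy–Khintchine expression, which extends a Bernstein function continuously to `0`. -/
noncomputable def levyExponent (a b : ℝ) (νbar : Measure ℝ≥0) (x : ℝ) : ℝ :=
  a + b * x + ∫ s : ℝ≥0, (1 - Real.exp (-((s : ℝ) * x))) ∂νbar

theorem levyExponent_zero : levyExponent a b νbar 0 = a := by simp [levyExponent]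

theorem one_sub_exp_neg_mem {y : ℝ} (hy : 0 ≤ y) :
    0 ≤ 1 - Real.exp (-y) ∧ 1 - Real.exp (-y) ≤ min y 1 := by
  have h1 := Real.exp_le_one_iff.2 (neg_nonpos.2 hy)
  have h2 := Real.one_sub_le_exp_neg y
  have h3 := Real.exp_pos (-y)
  exact ⟨by linarith, le_min (by linarith) (by linarith)⟩

/-- The limit measure `b δ₀ + (1 - e^{-s}) νbar(ds)`. -/
noncomputable def tiltedMeasure (b : ℝ) (νbar : Measure ℝ≥0) : Measure ℝ≥0 :=
  ENNReal.ofReal b • Measure.dirac 0 +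
    νbar.withDensity fun s => ENNReal.ofReal (1 - Real.exp (-(s : ℝ)))

namespace IsBernsteinWithTriplet

theorem ae_ne_zero (hf : IsBernsteinWithTriplet f a b νbar) : ∀ᵐ s ∂νbar, s ≠ 0 := by
  rw [ae_iff]; simpa using hf.no_mass_zero

/-- `νbar` is absolutely continuous with respect to the finite measure `min z 1 • νbar`, whose
density vanishes only at the `νbar`-null point `0`. This makes Fubini available. -/
theorem sfinite (hf : IsBernsteinWithTriplet f a b νbar) : SFinite νbar := by
  have hm : Measurable fun z : ℝ≥0 => ((min z 1 : ℝ≥0) : ℝ≥0∞) := by fun_prop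
  have : IsFiniteMeasure (νbar.withDensity fun z => ((min z 1 : ℝ≥0) : ℝ≥0∞)) :=
    isFiniteMeasure_withDensity hf.integrability.ne
  refine sFinite_of_absolutelyContinuous
    (withDensity_absolutelyContinuous' hm.aemeasurable ?_)
  filter_upwards [hf.ae_ne_zero] with s hs
  simpa using hs

theorem integrable_min (hf : IsBernsteinWithTriplet f a b νbar) :
    Integrable (fun s : ℝ≥0 => ((min s 1 : ℝ≥0) : ℝ)) νbar := by
  refine ⟨by fun_prop, ?_⟩
  rw [HasFiniteIntegral]
  convert hf.integrability using 3 with s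
  rw [Real.enorm_of_nonneg (NNReal.coe_nonneg _), ENNReal.ofReal_coe_nnreal]

theorem integrable_of_le (hf : IsBernsteinWithTriplet f a b νbar) {E : Type*}
    [NormedAddCommGroup E] {φ : ℝ≥0 → E} (hφ : AEStronglyMeasurable φ νbar) {C : ℝ}
    (h : ∀ s, ‖φ s‖ ≤ C * ((min s 1 : ℝ≥0) : ℝ)) : Integrable φ νbar :=
  (hf.integrable_min.const_mul C).mono' hφ (ae_of_all _ h)

theorem norm_one_sub_exp_le {x : ℝ} (hx : 0 ≤ x) (s : ℝ≥0) :
    ‖1 - Real.exp (-((s : ℝ) * x))‖ ≤ (x + 1) * ((min s 1 : ℝ≥0) : ℝ) := by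
  have hs := s.coe_nonneg
  obtain ⟨h1, h2⟩ := one_sub_exp_neg_mem (mul_nonneg hs hx)
  rw [Real.norm_of_nonneg h1]
  refine h2.trans ?_
  rw [NNReal.coe_min, NNReal.coe_one]
  rcases le_total (s : ℝ) 1 with h | h
  · rw [min_eq_left h]; exact (min_le_left _ _).trans (by nlinarith)
  · rw [min_eq_right h]; exact (min_le_right _ _).trans (by linarith)

theorem integrable_one_sub_exp (hf : IsBernsteinWithTriplet f a b νbar) {x : ℝ} (hx : 0 ≤ x) :
    Integrable (fun s : ℝ≥0 => 1 - Real.exp (-((s : ℝ) * x))) νbar :=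
  hf.integrable_of_le (Continuous.aestronglyMeasurable (by fun_prop))
    (norm_one_sub_exp_le hx)

theorem tendsto_zero (hf : IsBernsteinWithTriplet f a b νbar) :
    Tendsto f (𝓝[>] 0) (𝓝 a) := by
  have h1 : Tendsto (fun x : ℝ => ∫ s : ℝ≥0, (1 - Real.exp (-((s : ℝ) * x))) ∂νbar) (𝓝[>] 0)
      (𝓝 (∫ _ : ℝ≥0, (0 : ℝ) ∂νbar)) := by
    refine tendsto_integral_filter_of_dominated_convergence
      (fun s : ℝ≥0 => 2 * ((min s 1 : ℝ≥0) : ℝ))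
      (Eventually.of_forall fun x => Continuous.aestronglyMeasurable (by fun_prop)) ?_
      (hf.integrable_min.const_mul 2) (ae_of_all _ fun s => ?_)
    · filter_upwards [Ioo_mem_nhdsGT (zero_lt_one' ℝ)] with x hx
      refine ae_of_all _ fun s => (norm_one_sub_exp_le hx.1.le s).trans ?_
      have := NNReal.coe_nonneg (min s 1)
      gcongr
      linarith [hx.2]
    · refine tendsto_nhdsWithin_of_tendsto_nhds ?_
      exact Continuous.tendsto' (by fun_prop) _ _ (by simp)
  have h2 : Tendsto (fun x : ℝ => a + b * x) (𝓝[>] 0) (𝓝 a) :=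
    tendsto_nhdsWithin_of_tendsto_nhds (Continuous.tendsto' (by fun_prop) _ _ (by simp))
  have h3 := h2.add h1
  rw [integral_zero, add_zero] at h3
  refine h3.congr' ?_
  filter_upwards [self_mem_nhdsWithin] with x hx using (hf.levyKhintchine x hx).symm

theorem isFiniteMeasure_withDensity_one_sub_exp (hf : IsBernsteinWithTriplet f a b νbar) :
    IsFiniteMeasure (νbar.withDensity fun s => ENNReal.ofReal (1 - Real.exp (-(s : ℝ)))) := by
  have := (hf.integrable_one_sub_exp zero_le_one).2
  simp only [mul_one] at this
  exact isFiniteMeasure_withDensity_ofReal this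

theorem isFiniteMeasure_tiltedMeasure (hf : IsBernsteinWithTriplet f a b νbar) :
    IsFiniteMeasure (tiltedMeasure b νbar) := by
  have := hf.isFiniteMeasure_withDensity_one_sub_exp
  have : IsFiniteMeasure (ENNReal.ofReal b • (Measure.dirac 0 : Measure ℝ≥0)) :=
    Measure.smul_finite _ ENNReal.ofReal_ne_top
  unfold tiltedMeasure
  infer_instance

end IsBernsteinWithTriplet

theorem integral_withDensity_one_sub_exp {B : Type*} [NormedAddCommGroup B] [NormedSpace ℝ B]
    (μ : Measure ℝ≥0) (φ : ℝ≥0 → B) :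
    ∫ s, φ s ∂(μ.withDensity fun s => ENNReal.ofReal (1 - Real.exp (-(s : ℝ)))) =
      ∫ s : ℝ≥0, (1 - Real.exp (-(s : ℝ))) • φ s ∂μ := by
  rw [integral_withDensity_eq_integral_toReal_smul (by fun_prop) (ae_of_all _ fun _ => by simp)]
  refine integral_congr_ae (ae_of_all _ fun s => ?_)
  simp only
  rw [ENNReal.toReal_ofReal (one_sub_exp_neg_mem s.coe_nonneg).1]

namespace IsBernsteinWithTriplet

theorem integral_tiltedMeasure (hf : IsBernsteinWithTriplet f a b νbar) {B : Type*}
    [NormedAddCommGroup B] [NormedSpace ℝ B] [CompleteSpace B] {φ : ℝ≥0 → B}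
    (hc : Continuous φ) {C : ℝ} (hb : ∀ s, ‖φ s‖ ≤ C) :
    ∫ s, φ s ∂(tiltedMeasure b νbar) =
      b • φ 0 + ∫ s : ℝ≥0, (1 - Real.exp (-(s : ℝ))) • φ s ∂νbar := by
  have := hf.isFiniteMeasure_withDensity_one_sub_exp
  have : IsFiniteMeasure (ENNReal.ofReal b • (Measure.dirac 0 : Measure ℝ≥0)) :=
    Measure.smul_finite _ ENNReal.ofReal_ne_top
  unfold tiltedMeasure
  rw [integral_add_measure (integrable_of_continuous_of_bounded _ hc hb)
    (integrable_of_continuous_of_bounded _ hc hb), integral_withDensity_one_sub_exp,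
    integral_smul_measure, integral_dirac, ENNReal.toReal_ofReal hf.b_nonneg]

/-- From `(1 - e^{-s}) e^{-rs} = (1 - e^{-(r+1)s}) - (1 - e^{-rs})`; the constant `a` cancels and
the drift leaves `b`, the mass at `0`. -/
theorem laplace_tiltedMeasure (hf : IsBernsteinWithTriplet f a b νbar) {r : ℝ} (hr : 0 ≤ r) :
    ∫ s : ℝ≥0, Real.exp (-(r * (s : ℝ))) ∂(tiltedMeasure b νbar) =
      levyExponent a b νbar (r + 1) - levyExponent a b νbar r := by
  rw [hf.integral_tiltedMeasure (by fun_prop) (C := 1) fun s => by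
    rw [Real.norm_eq_abs, abs_of_pos (Real.exp_pos _)]; exact exp_neg_mul_le_one hr s]
  have h : ∫ s : ℝ≥0, (1 - Real.exp (-(s : ℝ))) • Real.exp (-(r * (s : ℝ))) ∂νbar =
      ∫ s : ℝ≥0, (1 - Real.exp (-((s : ℝ) * (r + 1)))) ∂νbar -
        ∫ s : ℝ≥0, (1 - Real.exp (-((s : ℝ) * r))) ∂νbar := by
    rw [← integral_sub (hf.integrable_one_sub_exp (by linarith)) (hf.integrable_one_sub_exp hr)]
    refine integral_congr_ae (ae_of_all _ fun s => ?_)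
    simp only [smul_eq_mul]
    rw [show -((s : ℝ) * (r + 1)) = -(s : ℝ) + -(r * s) by ring, Real.exp_add,
      mul_comm (s : ℝ) r]
    ring
  rw [h]
  simp only [NNReal.coe_zero, mul_zero, neg_zero, Real.exp_zero, levyExponent, smul_eq_mul]
  ring

end IsBernsteinWithTriplet

/-! ### Transition probabilities -/

variable {Ω : Type*} [MeasurableSpace Ω] {P : Measure Ω} {σ : ℝ≥0 → Ω → ℝ≥0∞}

instance [IsFiniteMeasure P] (t : ℝ≥0) : IsFiniteMeasure (transitionProb P σ t) := by
  unfold transitionProb; infer_instance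

/-- The exponent is prescribed only for `l > 0`. Letting `l → 0` adds the value at `0`: the total
mass of `μ_t` is `e^{-ta}`, so `a` is the killing rate. -/
theorem HasLaplaceExponent.laplace_eq [IsFiniteMeasure P]
    (hexp : HasLaplaceExponent P σ f) (hf : IsBernsteinWithTriplet f a b νbar) (t : ℝ≥0) {l : ℝ}
    (hl : 0 ≤ l) : ∫ s : ℝ≥0, Real.exp (-(l * (s : ℝ))) ∂(transitionProb P σ t) =
      Real.exp (-((t : ℝ) * levyExponent a b νbar l)) := by
  rcases hl.eq_or_lt with rfl | hl
  · rw [levyExponent_zero]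
    refine tendsto_nhds_unique (tendsto_laplace_zero _) ?_
    have : Tendsto (fun l => Real.exp (-((t : ℝ) * f l))) (𝓝[>] 0)
        (𝓝 (Real.exp (-((t : ℝ) * a)))) :=
      (Real.continuous_exp.tendsto _).comp (hf.tendsto_zero.const_mul (t : ℝ)).neg
    refine this.congr' ?_
    filter_upwards [self_mem_nhdsWithin] with l hl using (hexp t l hl).symm
  · rw [hexp t l hl, hf.levyKhintchine l hl]; rfl

end Bernstein

/-! ### Uniqueness and convolution for Laplace transforms. -/

section LaplaceUniqueness

variable {B : Type*} [NormedAddCommGroup B] [NormedSpace ℝ B] [CompleteSpace B]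

theorem integral_eq_of_laplace_eq {m m' : Measure ℝ≥0} [IsFiniteMeasure m] [IsFiniteMeasure m']
    (h : ∀ r : ℝ, 0 ≤ r → ∫ s : ℝ≥0, Real.exp (-(r * (s : ℝ))) ∂m =
      ∫ s : ℝ≥0, Real.exp (-(r * (s : ℝ))) ∂m')
    {φ : ℝ≥0 → B} (hc : Continuous φ) {C : ℝ} (hb : ∀ s, ‖φ s‖ ≤ C) :
    ∫ s, φ s ∂m = ∫ s, φ s ∂m' :=
  tendsto_nhds_unique tendsto_const_nhds
    (tendsto_integral_of_tendsto_laplace (l := (atTop : Filter ℕ)) (m := fun _ => m) (m₀ := m')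
      (fun r hr => by rw [h r hr]; exact tendsto_const_nhds) hc hb)

theorem laplace_conv (m m' : Measure ℝ≥0) [IsFiniteMeasure m] [IsFiniteMeasure m'] {r : ℝ}
    (hr : 0 ≤ r) : ∫ s : ℝ≥0, Real.exp (-(r * (s : ℝ))) ∂(m ∗ m') =
      (∫ s : ℝ≥0, Real.exp (-(r * (s : ℝ))) ∂m) * ∫ s : ℝ≥0, Real.exp (-(r * (s : ℝ))) ∂m' := by
  rw [integral_conv (integrable_exp_neg_mul _ hr), ← integral_mul_const]
  refine integral_congr_ae (ae_of_all _ fun x => ?_)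
  simp only
  rw [← integral_const_mul]
  refine integral_congr_ae (ae_of_all _ fun y => ?_)
  simp only
  rw [← Real.exp_add, NNReal.coe_add]
  congr 1; ring

end LaplaceUniqueness

/-! ### Contraction semigroups -/

section Contraction

variable {𝕜 B : Type*} [RCLike 𝕜] [NormedAddCommGroup B] [NormedSpace 𝕜 B]
  {T : ℝ≥0 → B →L[𝕜] B}

namespace IsC0Semigroup

theorem zero_apply (hT : IsC0Semigroup T) (u : B) : T 0 u = u := by rw [hT.zero]; rfl

theorem add_apply (hT : IsC0Semigroup T) (s t : ℝ≥0) (u : B) : T (s + t) u = T s (T t u) := by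
  rw [hT.add]; rfl

theorem comm_apply (hT : IsC0Semigroup T) (s t : ℝ≥0) (u : B) : T s (T t u) = T t (T s u) := by
  rw [← hT.add_apply, add_comm, hT.add_apply]

/-- For `s ≤ t` the difference is `T_s (u - T_{t-s} u)`, and `T_s` is a contraction. -/
theorem dist_le (hT : IsC0Semigroup T) (hc : ∀ s u, ‖T s u‖ ≤ ‖u‖) (s t : ℝ≥0) (u : B) :
    dist (T s u) (T t u) ≤ dist (T (nndist s t) u) u := by
  wlog h : s ≤ t generalizing s t
  · rw [dist_comm, nndist_comm]; exact this t s (le_of_not_ge h)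
  obtain ⟨r, rfl⟩ := exists_add_of_le h
  have : nndist s (s + r) = r := by
    ext; rw [coe_nndist, NNReal.dist_eq, NNReal.coe_add]; simp
  rw [this, hT.add_apply, dist_comm, dist_eq_norm, ← map_sub, dist_eq_norm]
  exact hc _ _

theorem continuous_orbit (hT : IsC0Semigroup T) (hc : ∀ s u, ‖T s u‖ ≤ ‖u‖) (u : B) :
    Continuous fun s => T s u := by
  rw [continuous_iff_continuousAt]
  intro s
  have h1 : Tendsto (fun t => nndist t s) (𝓝 s) (𝓝 0) :=
    Continuous.tendsto' (by fun_prop) _ _ (nndist_self s)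
  have h2 := tendsto_iff_dist_tendsto_zero.1 ((hT.tendsto u).comp h1)
  exact tendsto_iff_dist_tendsto_zero.2
    (squeeze_zero (fun _ => dist_nonneg) (fun t => hT.dist_le hc t s u) h2)

theorem continuous_uncurry (hT : IsC0Semigroup T) (hc : ∀ s u, ‖T s u‖ ≤ ‖u‖) :
    Continuous fun x : ℝ≥0 × B => T x.1 x.2 := by
  refine continuous_prod_of_continuous_lipschitzWith' _ 1
    (fun s => LipschitzWith.of_dist_le_mul fun u v => ?_) fun u => hT.continuous_orbit hc u
  simp only [dist_eq_norm, ← map_sub]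
  simpa using hc s (u - v)

end IsC0Semigroup

variable [NormedSpace ℝ B]

theorem ContinuousLinearMap.map_real_smul' (L : B →L[𝕜] B) (c : ℝ) (u : B) :
    L (c • u) = c • L u := map_real_smul L L.continuous c u

theorem IsGeneratorValue.map (hT : IsC0Semigroup T) {u v : B} (h : IsGeneratorValue T u v)
    (t : ℝ≥0) : IsGeneratorValue T (T t u) (T t v) := by
  refine (((T t).continuous.tendsto v).comp h).congr fun r => ?_
  simp only [Function.comp_apply]
  rw [ContinuousLinearMap.map_real_smul', map_sub, hT.comm_apply]

theorem IsGeneratorValue.hasDerivWithinAt (hT : IsC0Semigroup T) {u v : B}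
    (h : IsGeneratorValue T u v) (t : ℝ) :
    HasDerivWithinAt (fun s : ℝ => T (s - t).toNNReal u) v (Ici t) t := by
  rw [← hasDerivWithinAt_Ioi_iff_Ici, hasDerivWithinAt_iff_tendsto_slope' self_notMem_Ioi]
  have h1 : Tendsto (fun s : ℝ => (s - t).toNNReal) (𝓝[>] t) (𝓝[>] 0) := by
    refine tendsto_nhdsWithin_iff.2 ⟨tendsto_nhdsWithin_of_tendsto_nhds ?_, ?_⟩
    · exact (continuous_real_toNNReal.comp (by fun_prop)).tendsto' _ _ (by simp)
    · filter_upwards [self_mem_nhdsWithin] with s hs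
      exact Real.toNNReal_pos.2 (sub_pos.2 hs)
  refine (h.comp h1).congr' ?_
  filter_upwards [self_mem_nhdsWithin] with s hs
  simp only [Function.comp_apply, slope, vsub_eq_sub, sub_self, Real.toNNReal_zero,
    hT.zero_apply, Real.coe_toNNReal _ (sub_nonneg.2 (le_of_lt hs))]

/-- Orbits in the domain of the generator are differentiable. -/
theorem IsGeneratorValue.hasDerivAt [CompleteSpace B] (hT : IsC0Semigroup T)
    (hc : ∀ s u, ‖T s u‖ ≤ ‖u‖) {u v : B} (h : IsGeneratorValue T u v) {t : ℝ} (ht : 0 < t) :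
    HasDerivAt (fun s : ℝ => T s.toNNReal u) (T t.toNNReal v) t := by
  have hcu : Continuous fun s : ℝ => T s.toNNReal u :=
    (hT.continuous_orbit hc u).comp continuous_real_toNNReal
  have hcv : Continuous fun s : ℝ => T s.toNNReal v :=
    (hT.continuous_orbit hc v).comp continuous_real_toNNReal
  have hint : ∀ s, HasDerivAt (fun s : ℝ => u + ∫ r in (0 : ℝ)..s, T r.toNNReal v)
      (T s.toNNReal v) s := fun s =>
    (hcv.integral_hasStrictDerivAt 0 s).hasDerivAt.const_add u
  have hright : ∀ x ∈ Ico 0 (t + 1), HasDerivWithinAt (fun s : ℝ => T s.toNNReal u)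
      (T x.toNNReal v) (Ici x) x := by
    intro x hx
    refine ((h.map hT x.toNNReal).hasDerivWithinAt hT x).congr (fun y hy => ?_) ?_
    · rw [← hT.add_apply, ← Real.toNNReal_add (sub_nonneg.2 hy) hx.1, sub_add_cancel]
    · rw [sub_self, Real.toNNReal_zero, hT.zero_apply]
  -- The orbit and the primitive `u + ∫_0^s T_r v dr` are continuous with equal right derivatives
  -- and initial values, so they coincide; the primitive is differentiable from both sides.
  have heq := eq_of_has_deriv_right_eq hright (fun x _ => (hint x).hasDerivWithinAt)
    hcu.continuousOn (fun x _ => (hint x).continuousAt.continuousWithinAt)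
    (by simp [hT.zero_apply])
  refine (hint t).congr_of_eventuallyEq ?_
  filter_upwards [Ioo_mem_nhds ht (lt_add_one t)] with s hs
  exact heq s (Ioo_subset_Icc_self hs)

/-- Uniqueness for the Cauchy problem: `ψ(s) = T_{t-s} q(s)` has right derivative zero, so `q(t) =
ψ(t) = ψ(0) = T_t q(0)`. -/
theorem IsC0Semigroup.eq_of_hasDerivAt (hT : IsC0Semigroup T)
    (hc : ∀ s u, ‖T s u‖ ≤ ‖u‖) {q v : ℝ → B} (hq : ContinuousOn q (Ici 0))
    (hd : ∀ t, 0 < t → HasDerivAt q (v t) t) (hg : ∀ t, 0 < t → IsGeneratorValue T (q t) (v t))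
    (t : ℝ≥0) : q t = T t (q 0) := by
  rcases eq_or_ne t 0 with rfl | ht0
  · rw [NNReal.coe_zero, hT.zero_apply]
  have ht : (0 : ℝ) < t := NNReal.coe_pos.2 (pos_iff_ne_zero.2 ht0)
  set ψ : ℝ → B := fun s => T ((t : ℝ) - s).toNNReal (q s) with hψ
  have hψc : ContinuousOn ψ (Ici 0) := by
    refine (hT.continuous_uncurry hc).comp_continuousOn (f := fun s : ℝ =>
      (((t : ℝ) - s).toNNReal, q s)) (ContinuousOn.prodMk ?_ hq)
    exact (continuous_real_toNNReal.comp (by fun_prop)).continuousOn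
  have hder : ∀ s ∈ Ioo (0 : ℝ) t, HasDerivWithinAt ψ 0 (Ici s) s := by
    intro s hs
    -- `ψ(x) - ψ(s) = T_{t-x} D(x)`, and `D` has right derivative `v(s) - v(s) = 0` at `s`.
    -- Contractivity carries `D(x) = o(x - s)` over to `ψ`, with no product rule.
    set D : ℝ → B := fun x => q x - T (x - s).toNNReal (q s) with hD
    have h1 : HasDerivWithinAt D 0 (Ici s) s := by
      have := (hd s hs.1).hasDerivWithinAt.sub ((hg s hs.1).hasDerivWithinAt hT s)
      rwa [sub_self] at this
    have hDs : D s = 0 := by simp [hD, hT.zero_apply]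
    rw [hasDerivWithinAt_iff_isLittleO] at h1 ⊢
    refine Asymptotics.IsBigO.trans_isLittleO (Asymptotics.IsBigO.of_bound 1 ?_) h1
    filter_upwards [self_mem_nhdsWithin, mem_nhdsWithin_of_mem_nhds (Iio_mem_nhds hs.2)]
      with x hx hxt
    have e : ψ s = T ((t : ℝ) - x).toNNReal (T (x - s).toNNReal (q s)) := by
      rw [hψ, ← hT.add_apply, ← Real.toNNReal_add (sub_nonneg.2 (le_of_lt hxt)) (sub_nonneg.2 hx)]
      simp
    simp only [smul_zero, sub_zero, hDs, e, one_mul]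
    rw [hψ, hD, ← map_sub]
    exact hc _ _
  -- The equation holds only for positive times, so `0` is reached by continuity.
  have hconst : ∀ ε ∈ Ioo (0 : ℝ) t, ψ t = ψ ε := fun ε hε =>
    constant_of_has_deriv_right_zero (hψc.mono fun x hx => hε.1.le.trans hx.1)
      (fun x hx => hder x ⟨hε.1.trans_le hx.1, hx.2⟩) t ⟨hε.2.le, le_rfl⟩
  have h0 : Tendsto ψ (𝓝[>] 0) (𝓝 (ψ 0)) :=
    (hψc 0 self_mem_Ici).mono_left (nhdsWithin_mono _ Ioi_subset_Ici_self)
  have hev : ψ t = ψ 0 := by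
    refine tendsto_nhds_unique (tendsto_const_nhds.congr' ?_) h0
    filter_upwards [Ioo_mem_nhdsGT ht] with ε hε using hconst ε hε
  simpa [hψ, hT.zero_apply] using hev

end Contraction

/-! ### Subordination in the sense of Bochner -/

section Subordination

variable {𝕜 B : Type*} [RCLike 𝕜] [NormedAddCommGroup B] [NormedSpace 𝕜 B]
  {T : ℝ≥0 → B →L[𝕜] B}

theorem IsC0Semigroup.integrable_orbit (hT : IsC0Semigroup T) (hc : ∀ s u, ‖T s u‖ ≤ ‖u‖)
    (m : Measure ℝ≥0) [IsFiniteMeasure m] (u : B) : Integrable (fun s => T s u) m :=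
  integrable_of_continuous_of_bounded m (hT.continuous_orbit hc u) fun s => hc s u

variable [NormedSpace ℝ B]

/-- The operator `u ↦ ∫ T_s u m(ds)`. -/
noncomputable def subordinate [SMulCommClass ℝ 𝕜 B] (hT : IsC0Semigroup T)
    (hc : ∀ s u, ‖T s u‖ ≤ ‖u‖) (m : Measure ℝ≥0) [IsFiniteMeasure m] : B →L[𝕜] B :=
  LinearMap.mkContinuous
    { toFun := fun u => ∫ s, T s u ∂m
      map_add' := fun u v => by
        simp only [map_add]
        exact integral_add (hT.integrable_orbit hc m u) (hT.integrable_orbit hc m v)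
      map_smul' := fun c u => by
        simp only [map_smul, RingHom.id_apply]
        exact integral_smul c _ } (m.real univ) fun u => by
    refine (norm_integral_le_of_norm_le_const (ae_of_all m fun s => hc s u)).trans_eq ?_
    exact mul_comm _ _

variable [SMulCommClass ℝ 𝕜 B] (hT : IsC0Semigroup T) (hc : ∀ s u, ‖T s u‖ ≤ ‖u‖)

theorem subordinate_apply (m : Measure ℝ≥0) [IsFiniteMeasure m] (u : B) :
    subordinate hT hc m u = ∫ s, T s u ∂m := rfl

theorem norm_subordinate_le (m : Measure ℝ≥0) [IsFiniteMeasure m] :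
    ‖subordinate hT hc m‖ ≤ m.real univ :=
  LinearMap.mkContinuous_norm_le _ measureReal_nonneg _

variable {f : ℝ → ℝ} {a b : ℝ} {νbar : Measure ℝ≥0} (hf : IsBernsteinWithTriplet f a b νbar)
  {μ : ℝ≥0 → Measure ℝ≥0} [∀ t, IsFiniteMeasure (μ t)]
  (hμ : ∀ (t : ℝ≥0) (r : ℝ), 0 ≤ r → ∫ s : ℝ≥0, Real.exp (-(r * (s : ℝ))) ∂(μ t) =
    Real.exp (-((t : ℝ) * levyExponent a b νbar r)))

include hμ in
omit [∀ t, IsFiniteMeasure (μ t)] in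
theorem measureReal_univ_of_laplace (t : ℝ≥0) :
    (μ t).real univ = Real.exp (-((t : ℝ) * a)) := by
  have := hμ t 0 le_rfl
  rw [levyExponent_zero] at this
  simpa using this

include hf hμ in
theorem norm_subordinate_le_one (t : ℝ≥0) : ‖subordinate hT hc (μ t)‖ ≤ 1 := by
  refine (norm_subordinate_le hT hc (μ t)).trans ?_
  rw [measureReal_univ_of_laplace hμ]
  exact Real.exp_le_one_iff.2 (by have := mul_nonneg t.coe_nonneg hf.a_nonneg; linarith)

include hμ in
-- On orbits, `μ_0` acts as `δ₀` and `μ_{s+t}` as `μ_s ∗ μ_t`, since the Laplace transforms agree;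
-- as `t → 0` the transforms of `μ_t` tend to that of `δ₀`.
theorem isC0Semigroup_subordinate [CompleteSpace B] :
    IsC0Semigroup fun t => subordinate hT hc (μ t) := by
  refine ⟨?_, fun s t => ?_, fun u => ?_⟩
  · ext1 u
    rw [subordinate_apply, integral_eq_of_laplace_eq (m' := Measure.dirac 0) (fun r hr => by
      rw [hμ 0 r hr]; simp) (hT.continuous_orbit hc u) (fun s => hc s u), integral_dirac,
      hT.zero_apply]
    rfl
  · ext1 u
    have hco := hT.continuous_orbit hc u
    rw [subordinate_apply, integral_eq_of_laplace_eq (m' := μ s ∗ μ t) (fun r hr => by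
      rw [hμ _ r hr, laplace_conv _ _ hr, hμ _ r hr, hμ _ r hr, ← Real.exp_add, NNReal.coe_add]
      congr 1; ring) hco (fun s => hc s u),
      integral_conv (hT.integrable_orbit hc _ u), ContinuousLinearMap.comp_apply,
      subordinate_apply]
    refine integral_congr_ae (ae_of_all _ fun x => ?_)
    simp only [hT.add_apply, subordinate_apply]
    have := ((T x).restrictScalars ℝ).integral_comp_comm (hT.integrable_orbit hc (μ t) u)
    exact this
  · have := tendsto_integral_of_tendsto_laplace (l := 𝓝 0) (m := μ) (m₀ := Measure.dirac 0)
      (fun r hr => by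
        simp_rw [hμ _ r hr]
        exact Continuous.tendsto' (by fun_prop) _ _ (by simp))
      (hT.continuous_orbit hc u) (fun s => hc s u)
    rwa [integral_dirac, hT.zero_apply] at this

/-- The difference quotients of a contraction semigroup, normalised by `1 - e^{-s}`. -/
noncomputable def normalizedQuotient (T : ℝ≥0 → B →L[𝕜] B) (u v : B) : ℝ≥0 → B :=
  Function.update (fun s : ℝ≥0 => (1 - Real.exp (-(s : ℝ)))⁻¹ • (T s u - u)) 0 v

theorem tendsto_mul_inv_one_sub_exp :
    Tendsto (fun s : ℝ≥0 => (1 - Real.exp (-(s : ℝ)))⁻¹ * (s : ℝ)) (𝓝[>] 0) (𝓝 1) := by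
  have h : HasDerivAt (fun x : ℝ => 1 - Real.exp (-x)) 1 0 := by
    have := ((hasDerivAt_neg (0 : ℝ)).exp).const_sub 1
    simpa using this
  have h2 := (h.tendsto_slope_zero_right.comp tendsto_coe_nhdsGT_zero).inv₀ one_ne_zero
  rw [inv_one] at h2
  refine h2.congr fun s => ?_
  simp [mul_comm]

omit [SMulCommClass ℝ 𝕜 B] in
theorem one_sub_exp_smul_normalizedQuotient (hT : IsC0Semigroup T) (u v : B) (s : ℝ≥0) :
    (1 - Real.exp (-(s : ℝ))) • normalizedQuotient T u v s = T s u - u := by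
  by_cases hs : s = 0
  · subst hs; simp [hT.zero_apply]
  · rw [normalizedQuotient, Function.update_of_ne hs, smul_smul, mul_inv_cancel₀, one_smul]
    have : (0 : ℝ) < s := NNReal.coe_pos.2 (pos_iff_ne_zero.2 hs)
    have := Real.exp_lt_one_iff.2 (neg_lt_zero.2 this)
    linarith

/-- The measure `t⁻¹ (1 - e^{-s}) μ(ds)`. -/
noncomputable def tiltedQuotient (μ : Measure ℝ≥0) (t : ℝ≥0) : Measure ℝ≥0 :=
  ENNReal.ofReal ((t : ℝ)⁻¹) • μ.withDensity fun s => ENNReal.ofReal (1 - Real.exp (-(s : ℝ)))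

instance (μ : Measure ℝ≥0) [IsFiniteMeasure μ] (t : ℝ≥0) :
    IsFiniteMeasure (tiltedQuotient μ t) := by
  have : IsFiniteMeasure
      (μ.withDensity fun s => ENNReal.ofReal (1 - Real.exp (-(s : ℝ)))) :=
    isFiniteMeasure_withDensity_ofReal (integrable_of_continuous_of_bounded _ (by fun_prop)
      (C := 1) fun s => by
        obtain ⟨h1, h2⟩ := one_sub_exp_neg_mem s.coe_nonneg
        rw [Real.norm_of_nonneg h1]; exact h2.trans (min_le_right _ _)).2
  exact Measure.smul_finite _ ENNReal.ofReal_ne_top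

theorem integral_tiltedQuotient {E : Type*} [NormedAddCommGroup E] [NormedSpace ℝ E]
    (μ : Measure ℝ≥0) (t : ℝ≥0) (φ : ℝ≥0 → E) : ∫ s, φ s ∂(tiltedQuotient μ t) =
      (t : ℝ)⁻¹ • ∫ s : ℝ≥0, (1 - Real.exp (-(s : ℝ))) • φ s ∂μ := by
  rw [tiltedQuotient, integral_smul_measure, integral_withDensity_one_sub_exp,
    ENNReal.toReal_ofReal (by positivity)]

omit [SMulCommClass ℝ 𝕜 B] in
include hT hc in
-- Since `1 - e^{-s} ~ s`, the limit at `0` is the generator value `v`, the value assigned there.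
theorem continuous_normalizedQuotient {u v : B} (h : IsGeneratorValue T u v) :
    Continuous (normalizedQuotient T u v) := by
  have hco := hT.continuous_orbit hc u
  rw [continuous_iff_continuousAt]
  intro s
  by_cases hs : s = 0
  · subst hs
    rw [normalizedQuotient, continuousAt_update_same]
    have hne : 𝓝[≠] (0 : ℝ≥0) = 𝓝[>] 0 := by
      congr 1; ext x; simp [pos_iff_ne_zero]
    rw [hne]
    have := tendsto_mul_inv_one_sub_exp.smul h
    rw [one_smul] at this
    refine this.congr' ?_
    filter_upwards [self_mem_nhdsWithin] with x hx
    have hx : (x : ℝ) ≠ 0 := NNReal.coe_ne_zero.2 (ne_of_gt hx)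
    rw [smul_smul, mul_assoc, mul_inv_cancel₀ hx, mul_one]
  · rw [normalizedQuotient, continuousAt_update_of_ne hs]
    refine ContinuousAt.smul (ContinuousAt.inv₀ (by fun_prop) ?_) (by fun_prop)
    have : (0 : ℝ) < s := NNReal.coe_pos.2 (pos_iff_ne_zero.2 hs)
    have := Real.exp_lt_one_iff.2 (neg_lt_zero.2 this)
    linarith

omit [SMulCommClass ℝ 𝕜 B] in
include hT hc in
-- Compactness on `[0, 1]`; beyond `1` the numerator is at most `2‖u‖` and the denominator at least
-- `1 - e^{-1}`.
theorem exists_norm_normalizedQuotient_le {u v : B} (h : IsGeneratorValue T u v) :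
    ∃ C, ∀ s, ‖normalizedQuotient T u v s‖ ≤ C := by
  have hcont := continuous_normalizedQuotient hT hc h
  obtain ⟨C, hC⟩ := (isCompact_Icc (a := (0 : ℝ≥0)) (b := 1)).exists_bound_of_continuousOn
    hcont.continuousOn
  have he : 0 < 1 - Real.exp (-1) := by
    have := Real.exp_lt_one_iff.2 (show (-1 : ℝ) < 0 by norm_num); linarith
  refine ⟨max C ((1 - Real.exp (-1))⁻¹ * (2 * ‖u‖)), fun s => ?_⟩
  rcases le_total s 1 with hs | hs
  · exact (hC s ⟨zero_le, hs⟩).trans (le_max_left _ _)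
  · refine le_trans ?_ (le_max_right _ _)
    have hs' : (1 : ℝ) ≤ s := by exact_mod_cast hs
    have h1 : 1 - Real.exp (-1) ≤ 1 - Real.exp (-(s : ℝ)) := by gcongr
    rw [normalizedQuotient, Function.update_of_ne (by positivity), norm_smul,
      Real.norm_of_nonneg (inv_nonneg.2 (he.le.trans h1))]
    gcongr
    refine (norm_sub_le _ _).trans ?_
    linarith [hc s u]

omit [SMulCommClass ℝ 𝕜 B] in
include hT hc hf in
theorem integrable_orbit_sub {u v : B} (h : IsGeneratorValue T u v) :
    Integrable (fun s => T s u - u) νbar := by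
  obtain ⟨C, hC⟩ := exists_norm_normalizedQuotient_le hT hc h
  have hC0 : 0 ≤ C := (norm_nonneg _).trans (hC 0)
  refine hf.integrable_of_le ((hT.continuous_orbit hc u).sub
    continuous_const).aestronglyMeasurable (C := 2 * C) fun s => ?_
  have h1 := IsBernsteinWithTriplet.norm_one_sub_exp_le zero_le_one s
  rw [mul_one] at h1
  rw [← one_sub_exp_smul_normalizedQuotient hT u v s, norm_smul]
  calc _ ≤ (1 + 1) * ((min s 1 : ℝ≥0) : ℝ) * C := by
        gcongr; exact hC s
    _ = _ := by ring

include hf hμ in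
/-- Phillips' theorem: on the domain of the generator of a contraction semigroup, the generator of
the subordinate semigroup is given by Phillips' expression. -/
theorem isGeneratorValue_subordinate [CompleteSpace B] {u v : B} (h : IsGeneratorValue T u v) :
    IsGeneratorValue (fun t => subordinate hT hc (μ t)) u (phillips a b νbar T u v) := by
  obtain ⟨C, hC⟩ := exists_norm_normalizedQuotient_le hT hc h
  have hcont := continuous_normalizedQuotient hT hc h
  have hfin0 := hf.isFiniteMeasure_tiltedMeasure
  have hexp : ∀ c : ℝ, Tendsto (fun t : ℝ≥0 => (t : ℝ)⁻¹ * (Real.exp (-((t : ℝ) * c)) - 1))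
      (𝓝[>] 0) (𝓝 (-c)) := by
    intro c
    have hd : HasDerivAt (fun x : ℝ => Real.exp (-(x * c))) (-c) 0 := by
      have := (((hasDerivAt_id (0 : ℝ)).mul_const c).neg).exp
      simpa using this
    refine (hd.tendsto_slope_zero_right.comp tendsto_coe_nhdsGT_zero).congr fun t => ?_
    simp
  have hlap : ∀ r : ℝ, 0 ≤ r → Tendsto (fun t => ∫ s : ℝ≥0, Real.exp (-(r * (s : ℝ))) ∂(tiltedQuotient (μ t) t))
      (𝓝[>] 0) (𝓝 (∫ s : ℝ≥0, Real.exp (-(r * (s : ℝ))) ∂(tiltedMeasure b νbar))) := by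
    intro r hr
    rw [hf.laplace_tiltedMeasure hr]
    have := (hexp (levyExponent a b νbar r)).sub (hexp (levyExponent a b νbar (r + 1)))
    rw [neg_sub_neg] at this
    refine this.congr fun t => ?_
    rw [integral_tiltedQuotient, ← mul_sub, sub_sub_sub_cancel_right, smul_eq_mul, ← hμ t r hr,
      ← hμ t (r + 1) (by linarith), ← integral_sub (integrable_exp_neg_mul _ hr)
        (integrable_exp_neg_mul _ (by linarith))]
    congr 1
    refine integral_congr_ae (ae_of_all _ fun s => ?_)
    simp only [smul_eq_mul]
    rw [show -((r + 1) * (s : ℝ)) = -(s : ℝ) + -(r * s) by ring, Real.exp_add]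
    ring
  have hmain := tendsto_integral_of_tendsto_laplace hlap hcont hC
  rw [hf.integral_tiltedMeasure hcont hC] at hmain
  simp_rw [integral_tiltedQuotient, one_sub_exp_smul_normalizedQuotient hT] at hmain
  have hphi0 : normalizedQuotient T u v 0 = v := by simp [normalizedQuotient]
  rw [hphi0] at hmain
  -- `∫ T_s u dμ_t - u` is `∫ (T_s u - u) dμ_t` plus the mass defect `(e^{-ta} - 1) u`, which
  -- contributes `-a u`.
  have hadd := ((hexp a).smul_const u).add hmain
  rw [neg_smul, ← add_assoc] at hadd
  refine hadd.congr fun t => ?_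
  rw [integral_sub (hT.integrable_orbit hc _ u) (integrable_const u), integral_const,
    measureReal_univ_of_laplace hμ, ← smul_smul, ← smul_add, sub_smul, one_smul,
    subordinate_apply]
  congr 1; abel

end Subordination

/-! ### Subordinate translations -/

section SubordinateTranslation

variable {𝕜 : Type*} [RCLike 𝕜] {p : ℝ≥0∞} [hp1 : Fact (1 ≤ p)]

theorem norm_leftTranslation_le (s : ℝ≥0) (u : Lp 𝕜 p (volume : Measure ℝ)) :
    ‖leftTranslation 𝕜 p s u‖ ≤ ‖u‖ := (norm_leftTranslation s u).le

theorem subordinate_leftTranslation_eval (hp : p ≠ ∞) (m : Measure ℝ≥0) [IsFiniteMeasure m]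
    {u : Lp 𝕜 p (volume : Measure ℝ)} {g : ℝ → 𝕜} (hg : StronglyMeasurable g)
    (hu : u =ᵐ[volume] g) :
    (∀ᵐ x : ℝ, Integrable (fun y : ℝ≥0 => g (x + (y : ℝ))) m) ∧
      subordinate (isC0Semigroup_leftTranslation hp) norm_leftTranslation_le m u =ᵐ[volume]
        fun x : ℝ => ∫ y : ℝ≥0, g (x + (y : ℝ)) ∂m :=
  Lp.integral_eval (k := fun (y : ℝ≥0) (x : ℝ) => g (x + (y : ℝ)))
    ((isC0Semigroup_leftTranslation hp).integrable_orbit norm_leftTranslation_le m u)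
    (hg.comp_measurable (by fun_prop)) (ae_of_all _ fun s => leftTranslation_coeFn s u hu)

/-- By Fubini, the averaged function has increments equal to the integrals of the averaged
derivative. -/
theorem hasSpaceDeriv_subordinate (hp : p ≠ ∞) (m : Measure ℝ≥0) [IsFiniteMeasure m]
    {u du : Lp 𝕜 p (volume : Measure ℝ)} (h : HasSpaceDeriv u du) :
    HasSpaceDeriv (subordinate (isC0Semigroup_leftTranslation hp) norm_leftTranslation_le m u)
      (subordinate (isC0Semigroup_leftTranslation hp) norm_leftTranslation_le m du) := by
  obtain ⟨g, hg, hu, hdu⟩ := h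
  set Su := subordinate (isC0Semigroup_leftTranslation hp) norm_leftTranslation_le m u
  set Sdu := subordinate (isC0Semigroup_leftTranslation hp) norm_leftTranslation_le m du
  have hSu := (subordinate_leftTranslation_eval hp m hg.continuous.stronglyMeasurable hu).2
  have hSdu := (subordinate_leftTranslation_eval hp m (stronglyMeasurable_deriv g) hdu).2
  -- Boundedness of `g` defines the averaged representative at every `x`, as absolute continuity
  -- requires.
  obtain ⟨C, hC⟩ := hg.exists_bound hp1.out
  have hint : ∀ x : ℝ, Integrable (fun y : ℝ≥0 => g (x + (y : ℝ))) m := fun x =>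
    integrable_of_continuous_of_bounded m (hg.continuous.comp (by fun_prop)) fun _ => hC _
  have hle : ∀ x y : ℝ, x ≤ y → ∫ s : ℝ≥0, g (y + (s : ℝ)) ∂m - ∫ s : ℝ≥0, g (x + (s : ℝ)) ∂m =
      ∫ t in x..y, Sdu t := by
    intro x y hxy
    have hprod := Lp.integrable_prod_restrict (A := Ioc x y)
      (k := fun (s : ℝ≥0) (t : ℝ) => deriv g (t + (s : ℝ)))
      ((isC0Semigroup_leftTranslation hp).integrable_orbit norm_leftTranslation_le m du)
      ((stronglyMeasurable_deriv g).comp_measurable (by fun_prop))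
      (ae_of_all _ fun s => leftTranslation_coeFn s du hdu) (by simp)
    rw [← integral_sub (hint y) (hint x), intervalIntegral.integral_of_le hxy,
      integral_congr_ae (ae_restrict_of_ae hSdu), ← integral_integral_swap hprod]
    refine integral_congr_ae (ae_of_all _ fun s => ?_)
    simp only
    rw [← intervalIntegral.integral_of_le hxy,
      intervalIntegral.integral_comp_add_right (fun t => deriv g t), hg.integral_deriv hp1.out]
  obtain ⟨h1, h2⟩ := MemW1p.of_sub_eq_integral (p := p) hp1.out
    (g := fun x => ∫ s : ℝ≥0, g (x + (s : ℝ)) ∂m) ((Lp.memLp Su).ae_eq hSu)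
    (Lp.memLp Sdu) fun x y => by
      rcases le_total x y with hxy | hxy
      · exact hle x y hxy
      · rw [intervalIntegral.integral_symm, ← hle y x hxy, neg_sub]
  exact ⟨_, h1, hSu, h2.symm⟩

omit hp1 in
theorem MemW1p.hasSpaceDeriv {g : ℝ → 𝕜} (hg : MemW1p p g) {u : Lp 𝕜 p (volume : Measure ℝ)}
    (hu : u =ᵐ[volume] g) : HasSpaceDeriv u (hg.memLp_deriv.toLp (deriv g)) :=
  ⟨g, hg, hu, hg.memLp_deriv.coeFn_toLp⟩

end SubordinateTranslation

/-! ### The Weyl-type derivative -/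

section Weyl

variable {f : ℝ → ℝ} {a b : ℝ} {νbar : Measure ℝ≥0}

namespace IsBernsteinWithTriplet

theorem measure_Ioi_lt_top (hf : IsBernsteinWithTriplet f a b νbar) {s : ℝ} (hs : 0 < s) :
    νbar {z : ℝ≥0 | s < (z : ℝ)} < ∞ := by
  refine (measure_mono ?_).trans_lt
    (hf.integrable_min.measure_ge_lt_top (lt_min hs zero_lt_one))
  intro z hz
  simp only [mem_ofPred_eq, NNReal.coe_min, NNReal.coe_one] at hz ⊢
  exact min_le_min_right 1 hz.le

theorem measurable_levyTail : Measurable (levyTail a νbar) := by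
  have h : Antitone fun s : ℝ => νbar {z : ℝ≥0 | s < (z : ℝ)} := fun s t hst =>
    measure_mono fun z hz => lt_of_le_of_lt hst hz
  exact h.measurable.ennreal_toReal.const_add a

theorem measurableSet_tail (s : ℝ) : MeasurableSet {z : ℝ≥0 | s < (z : ℝ)} :=
  measurableSet_lt measurable_const NNReal.continuous_coe.measurable

theorem measurableSet_tail_prod : MeasurableSet {x : ℝ × ℝ≥0 | x.1 < (x.2 : ℝ)} :=
  measurableSet_lt measurable_fst (NNReal.continuous_coe.measurable.comp measurable_snd)

theorem integral_indicator_tail {E : Type*} [NormedAddCommGroup E] [NormedSpace ℝ E]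
    [CompleteSpace E] (s : ℝ) (c : E) :
    ∫ z : ℝ≥0, {x : ℝ × ℝ≥0 | x.1 < (x.2 : ℝ)}.indicator (fun _ => c) (s, z) ∂νbar =
      (levyTail a νbar s - a) • c := by
  have : (fun z : ℝ≥0 => {x : ℝ × ℝ≥0 | x.1 < (x.2 : ℝ)}.indicator (fun _ => c) (s, z)) =
      {z : ℝ≥0 | s < (z : ℝ)}.indicator fun _ => c := rfl
  rw [this, integral_indicator_const c (measurableSet_tail s), levyTail, add_sub_cancel_left]

/-- By Fubini the integral of `νbar (s, ∞)` over `(0, R]` is that of `min R z` against `νbar`, for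
`R ≥ 0`, and `min R z ≤ max R 1 * min z 1`. -/
theorem integrableOn_levyTail (hf : IsBernsteinWithTriplet f a b νbar) (R : ℝ) :
    IntegrableOn (levyTail a νbar) (Ioc 0 R) volume := by
  have := hf.sfinite
  have hprod : Integrable ({x : ℝ × ℝ≥0 | x.1 < (x.2 : ℝ)}.indicator fun _ => (1 : ℝ))
      ((volume.restrict (Ioc 0 R)).prod νbar) := by
    have hm : StronglyMeasurable ({x : ℝ × ℝ≥0 | x.1 < (x.2 : ℝ)}.indicator fun _ => (1 : ℝ)) :=
      stronglyMeasurable_const.indicator measurableSet_tail_prod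
    rw [integrable_prod_iff' hm.aestronglyMeasurable]
    refine ⟨ae_of_all _ fun z => ?_, ?_⟩
    · refine Integrable.of_bound
        (hm.comp_measurable measurable_prodMk_right).aestronglyMeasurable 1
        (ae_of_all _ fun s => ?_)
      exact (norm_indicator_le_norm_self _ _).trans (by simp)
    · refine hf.integrable_of_le (C := max R 1) ?_ fun z => ?_
      · exact (hm.norm.integral_prod_left (f := fun s z => ‖{x : ℝ × ℝ≥0 | x.1 < (x.2 : ℝ)}.indicator
          (fun _ => (1 : ℝ)) (s, z)‖)).aestronglyMeasurable
      · rw [Real.norm_of_nonneg (integral_nonneg fun _ => norm_nonneg _)]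
        have e : (fun s : ℝ => ‖{x : ℝ × ℝ≥0 | x.1 < (x.2 : ℝ)}.indicator
            (fun _ => (1 : ℝ)) (s, z)‖) = (Iio (z : ℝ)).indicator fun _ => (1 : ℝ) := by
          ext s
          by_cases hs : s < (z : ℝ) <;> simp [hs]
        rw [e, setIntegral_indicator measurableSet_Iio, setIntegral_const, smul_eq_mul, mul_one]
        have h1 : volume.real (Ioc 0 R ∩ Iio (z : ℝ)) ≤ volume.real (Ioc 0 (min R z)) :=
          measureReal_mono (fun s hs => ⟨hs.1.1, le_min hs.1.2 (le_of_lt hs.2)⟩) (by simp)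
        refine h1.trans ?_
        rw [Real.volume_real_Ioc, sub_zero, NNReal.coe_min, NNReal.coe_one]
        have hz := z.coe_nonneg
        have hR1 := le_max_right R 1
        have hRR := le_max_left R 1
        refine max_le ?_ (by positivity)
        rcases le_total (z : ℝ) 1 with h | h
        · rw [min_eq_left h]; exact (min_le_right _ _).trans (by nlinarith)
        · rw [min_eq_right h, mul_one]; exact (min_le_left _ _).trans hRR
  have h2 := hprod.integral_prod_left
  simp_rw [integral_indicator_tail (a := a)] at h2
  have h3 := h2.add (integrable_const a)
  refine h3.congr (ae_of_all _ fun s => ?_)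
  simp

variable {𝕜 : Type*} [RCLike 𝕜] {p : ℝ≥0∞} [hp1 : Fact (1 ≤ p)] {g : ℝ → 𝕜}

/-- `ν` is integrable on `(0, n]` and translations are isometric, so `∫_0^n ν(s) T_s u' ds` is a
Bochner integral, and almost every point inherits integrability. Countably many `n` cover all `R`.
-/
theorem ae_integrableOn_levyTail_smul (hf : IsBernsteinWithTriplet f a b νbar) (hp : p ≠ ∞)
    (hg : MemW1p p g) :
    ∀ᵐ x : ℝ, ∀ R : ℝ, IntegrableOn (fun s => levyTail a νbar s • deriv g (x + s)) (Ioc 0 R)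
      volume := by
  have h : ∀ n : ℕ, ∀ᵐ x : ℝ,
      IntegrableOn (fun s => levyTail a νbar s • deriv g (x + s)) (Ioc 0 (n : ℝ)) volume := by
    intro n
    set du := hg.memLp_deriv.toLp (deriv g)
    have hF : Integrable (fun s : ℝ => levyTail a νbar s • leftTranslation 𝕜 p s.toNNReal du)
        (volume.restrict (Ioc 0 (n : ℝ))) := by
      refine ((hf.integrableOn_levyTail n).norm.mul_const ‖du‖).mono' ?_ (ae_of_all _ fun s => ?_)
      · exact measurable_levyTail.aestronglyMeasurable.smul
          ((continuous_leftTranslation hp du).comp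
            continuous_real_toNNReal).aestronglyMeasurable
      · rw [norm_smul, norm_leftTranslation]
    refine (Lp.integral_eval (k := fun s x => levyTail a νbar s • deriv g (x + s)) hF ?_ ?_).1
    · exact (measurable_levyTail.comp measurable_fst).stronglyMeasurable.smul
        ((stronglyMeasurable_deriv g).comp_measurable (by fun_prop))
    · filter_upwards [ae_restrict_mem measurableSet_Ioc] with s hs
      have h1 := leftTranslation_coeFn s.toNNReal du hg.memLp_deriv.coeFn_toLp
      rw [Real.coe_toNNReal s hs.1.le] at h1
      filter_upwards [h1, Lp.coeFn_smul (levyTail a νbar s)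
        (leftTranslation 𝕜 p s.toNNReal du)] with x h2 h3
      rw [h3, Pi.smul_apply, h2]
  filter_upwards [ae_all_iff.2 h] with x hx R
  obtain ⟨n, hn⟩ := exists_nat_ge R
  exact (hx n).mono_set (Ioc_subset_Ioc_right hn)

/-- Integration by parts in the form of Fubini: `ν(s) - a` is the `νbar`-integral of the indicator
of `s < z`, and integrating `g'(x+s)` over `0 < s < min R z` gives an increment of `g`. The
hypothesis `hx` supplies the absolute integrability. -/
theorem integral_levyTail_smul (hf : IsBernsteinWithTriplet f a b νbar) (hg : MemW1p p g) {x : ℝ}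
    {R : ℝ} (hR : 0 ≤ R)
    (hx : IntegrableOn (fun s => levyTail a νbar s • deriv g (x + s)) (Ioc 0 R) volume) :
    Integrable (fun z : ℝ≥0 => g (x + min R z) - g x) νbar ∧
      ∫ s in Ioc 0 R, levyTail a νbar s • deriv g (x + s) =
        a • (g (x + R) - g x) + ∫ z : ℝ≥0, (g (x + min R z) - g x) ∂νbar := by
  have := hf.sfinite
  have hshift : ∀ r, 0 ≤ r → ∫ s in Ioc 0 r, deriv g (x + s) = g (x + r) - g x := fun r hr => by
    rw [← intervalIntegral.integral_of_le hr,
      intervalIntegral.integral_comp_add_left (fun y => deriv g y) x, hg.integral_deriv hp1.out,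
      add_zero]
  have hloc : IntegrableOn (fun s => deriv g (x + s)) (Ioc 0 R) volume := by
    have h1 := ((hg.locallyIntegrable_deriv hp1.out).intervalIntegrable_of_real
      (x + 0) (x + R)).comp_add_left x
    simp only [add_sub_cancel_left] at h1
    exact (intervalIntegrable_iff_integrableOn_Ioc_of_le hR).1 h1
  set K : ℝ × ℝ≥0 → 𝕜 := fun y =>
    {x : ℝ × ℝ≥0 | x.1 < (x.2 : ℝ)}.indicator (fun _ => deriv g (x + y.1)) y with hK
  have hKm : StronglyMeasurable K :=
    StronglyMeasurable.indicator ((stronglyMeasurable_deriv g).comp_measurable (by fun_prop))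
      measurableSet_tail_prod
  have htail : Integrable (fun s => (levyTail a νbar s - a) • deriv g (x + s))
      (volume.restrict (Ioc 0 R)) := by
    simp_rw [sub_smul]
    exact hx.sub (hloc.smul a)
  have hKi : Integrable K ((volume.restrict (Ioc 0 R)).prod νbar) := by
    rw [integrable_prod_iff hKm.aestronglyMeasurable]
    refine ⟨?_, ?_⟩
    · filter_upwards [ae_restrict_mem measurableSet_Ioc] with s hs
      exact (integrableOn_const (C := deriv g (x + s))
        (hf.measure_Ioi_lt_top hs.1).ne).integrable_indicator (measurableSet_tail s)
    · refine htail.norm.congr (ae_of_all _ fun s => ?_)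
      have e : ∀ z, ‖K (s, z)‖ =
          {x : ℝ × ℝ≥0 | x.1 < (x.2 : ℝ)}.indicator (fun _ => ‖deriv g (x + s)‖) (s, z) :=
        fun z => norm_indicator_eq_indicator_norm _ _
      simp_rw [e]
      rw [integral_indicator_tail (a := a), norm_smul, smul_eq_mul, Real.norm_of_nonneg]
      simp [levyTail]
  have hinner : ∀ z : ℝ≥0, ∫ s in Ioc 0 R, K (s, z) = g (x + min R z) - g x := by
    intro z
    have e : (fun s => K (s, z)) = (Iio (z : ℝ)).indicator fun s => deriv g (x + s) := rfl
    rw [e, setIntegral_indicator measurableSet_Iio, ← hshift _ (le_min hR z.coe_nonneg),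
      ← Ioc_inter_Iic]
    exact setIntegral_congr_set ((ae_eq_refl _).inter Iio_ae_eq_Iic)
  refine ⟨?_, ?_⟩
  · have := hKi.integral_prod_right
    simpa only [hinner] using this
  · have h1 : ∫ s in Ioc 0 R, (levyTail a νbar s - a) • deriv g (x + s) =
        ∫ z : ℝ≥0, (g (x + min R z) - g x) ∂νbar := by
      simp_rw [← hinner]
      rw [← integral_integral_swap (f := fun s z => K (s, z)) hKi]
      refine integral_congr_ae (ae_of_all _ fun s => ?_)
      exact (integral_indicator_tail s _).symm
    have hloca : Integrable (fun s => a • deriv g (x + s)) (volume.restrict (Ioc 0 R)) :=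
      hloc.smul a
    rw [← h1, ← hshift R hR, ← integral_smul, ← integral_add hloca htail]
    refine integral_congr_ae (ae_of_all _ fun s => ?_)
    simp only
    rw [← add_smul, add_sub_cancel]

theorem tendsto_integral_levyTail_smul (hf : IsBernsteinWithTriplet f a b νbar) (hp : p ≠ ∞)
    (hg : MemW1p p g) {x : ℝ}
    (hx : ∀ R : ℝ, IntegrableOn (fun s => levyTail a νbar s • deriv g (x + s)) (Ioc 0 R) volume) :
    Tendsto (fun R : ℝ => ∫ s in Ioc 0 R, levyTail a νbar s • deriv g (x + s)) atTop
      (𝓝 (-(a • g x) + ∫ z : ℝ≥0, (g (x + z) - g x) ∂νbar)) := by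
  obtain ⟨C, hC⟩ := hg.exists_bound hp1.out
  have h1 : Tendsto (fun R : ℝ => a • (g (x + R) - g x)) atTop (𝓝 (-(a • g x))) := by
    have := (((hg.tendsto_zero hp1.out hp).comp
      (tendsto_atTop_add_const_left atTop x tendsto_id)).sub_const (g x)).const_smul a
    rwa [zero_sub, smul_neg] at this
  have h2 : Tendsto (fun R : ℝ => ∫ z : ℝ≥0, (g (x + min R z) - g x) ∂νbar) atTop
      (𝓝 (∫ z : ℝ≥0, (g (x + z) - g x) ∂νbar)) := by
    -- A majorant for all `R ≥ 1`: the integrand for `R = 1` controls `z ≤ 1`, and `2C` controls `z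
    -- > 1`, a set of finite `νbar`-measure.
    have hb := ((hf.integral_levyTail_smul hg zero_le_one (hx 1)).1.norm).add
      ((integrableOn_const (C := 2 * C) (hf.measure_Ioi_lt_top zero_lt_one).ne).integrable_indicator
        (measurableSet_tail 1))
    refine tendsto_integral_filter_of_dominated_convergence _ (Eventually.of_forall fun R => ?_)
      ?_ hb (ae_of_all _ fun z => ?_)
    · exact ((hg.continuous.comp (by fun_prop)).sub continuous_const).aestronglyMeasurable
    · filter_upwards [eventually_ge_atTop 1] with R hR
      refine ae_of_all _ fun z => ?_
      simp only [Pi.add_apply]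
      by_cases hz : 1 < (z : ℝ)
      · rw [indicator_of_mem (show z ∈ {z : ℝ≥0 | (1 : ℝ) < z} from hz)]
        have := (norm_sub_le (g (x + min R z)) (g x)).trans (add_le_add (hC _) (hC _))
        have := norm_nonneg (g (x + min 1 (z : ℝ)) - g x)
        linarith
      · rw [indicator_of_notMem (show z ∉ {z : ℝ≥0 | (1 : ℝ) < z} from hz), add_zero]
        rw [min_eq_right ((not_lt.1 hz).trans hR), min_eq_right (not_lt.1 hz)]
    · refine tendsto_const_nhds.congr' ?_
      filter_upwards [eventually_ge_atTop (z : ℝ)] with R hR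
      rw [min_eq_right hR]
  refine (h1.add h2).congr' ?_
  filter_upwards [eventually_ge_atTop 0] with R hR
  exact (hf.integral_levyTail_smul hg hR (hx R)).2.symm

theorem phillips_leftTranslation_eval (hf : IsBernsteinWithTriplet f a b νbar) (hp : p ≠ ∞)
    {u du : Lp 𝕜 p (volume : Measure ℝ)} (hg : MemW1p p g) (hu : u =ᵐ[volume] g)
    (hdu : du =ᵐ[volume] deriv g) :
    (phillips a b νbar (leftTranslation 𝕜 p) u du : Lp 𝕜 p (volume : Measure ℝ)) =ᵐ[volume] fun x =>
      -(a • g x) + b • deriv g x + ∫ z : ℝ≥0, (g (x + z) - g x) ∂νbar := by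
  have := hf.sfinite
  have hgen := HasSpaceDeriv.isGeneratorValue hp ⟨g, hg, hu, hdu⟩
  have hint := integrable_orbit_sub (isC0Semigroup_leftTranslation hp) norm_leftTranslation_le hf
    hgen
  have hgm := hg.continuous.stronglyMeasurable
  have hev := (Lp.integral_eval (k := fun (z : ℝ≥0) (x : ℝ) => g (x + z) - g x) hint
    ((hgm.comp_measurable (by fun_prop)).sub (hgm.comp_measurable (by fun_prop)))
    (ae_of_all _ fun z => by
      filter_upwards [Lp.coeFn_sub (leftTranslation 𝕜 p z u) u, leftTranslation_coeFn z u hu, hu]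
        with x h1 h2 h3
      rw [h1, Pi.sub_apply, h2, h3])).2
  unfold phillips
  filter_upwards [hev, hu, hdu, Lp.coeFn_smul a u, Lp.coeFn_smul b du, Lp.coeFn_neg (a • u),
    Lp.coeFn_add (-(a • u)) (b • du),
    Lp.coeFn_add (-(a • u) + b • du) (∫ s, (leftTranslation 𝕜 p s u - u) ∂νbar)]
    with x h1 h2 h3 h4 h5 h6 h7 h8
  rw [h8, Pi.add_apply, h7, Pi.add_apply, h6, Pi.neg_apply, h5, h4, h1, Pi.smul_apply,
    Pi.smul_apply, h2, h3]

theorem isLeftWeylDeriv (hf : IsBernsteinWithTriplet f a b νbar) (hp : p ≠ ∞)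
    {u du : Lp 𝕜 p (volume : Measure ℝ)} (h : HasSpaceDeriv u du) :
    IsLeftWeylDeriv a b νbar u (-(phillips a b νbar (leftTranslation 𝕜 p) u du)) := by
  obtain ⟨g, hg, hu, hdu⟩ := h
  refine ⟨g, hg, hu, ?_⟩
  filter_upwards [hg.ae_differentiableAt, hf.ae_integrableOn_levyTail_smul hp hg,
    hf.phillips_leftTranslation_eval hp hg hu hdu,
    Lp.coeFn_neg (phillips a b νbar (leftTranslation 𝕜 p) u du)] with x h1 h2 h3 h4
  refine ⟨h1, h2, _, hf.tendsto_integral_levyTail_smul hp hg h2, ?_⟩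
  rw [h4, Pi.neg_apply, h3]
  congr 1; abel

end IsBernsteinWithTriplet

/-- Continuous representatives of one class agree everywhere, so the expression does not depend on
the choice. -/
theorem IsLeftWeylDeriv.unique {𝕜 : Type*} [RCLike 𝕜] {p : ℝ≥0∞}
    {u w w' : Lp 𝕜 p (volume : Measure ℝ)} (h : IsLeftWeylDeriv a b νbar u w)
    (h' : IsLeftWeylDeriv a b νbar u w') : w = w' := by
  obtain ⟨g, hg, hu, hw⟩ := h
  obtain ⟨g', hg', hu', hw'⟩ := h'
  have : g = g' := (hg.continuous.ae_eq_iff_eq volume hg'.continuous).1 (hu.symm.trans hu')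
  subst this
  refine Lp.ext ?_
  filter_upwards [hw, hw'] with x hx hx'
  obtain ⟨-, -, I, hI, e⟩ := hx
  obtain ⟨-, -, I', hI', e'⟩ := hx'
  rw [e, e', tendsto_nhds_unique hI hI']

end Weyl

/-! ### The main theorem. -/

theorem mainTheorem6 {𝕜 : Type*} [RCLike 𝕜] {Ω : Type*} [MeasurableSpace Ω]
    (P : Measure Ω) [IsProbabilityMeasure P]
    (f : ℝ → ℝ) (a b : ℝ) (νbar : Measure ℝ≥0) (hf : IsBernsteinWithTriplet f a b νbar)
    (σ : ℝ≥0 → Ω → ℝ≥0∞) (hσ : IsSubordinator P σ) (hexp : HasLaplaceExponent P σ f)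
    (p : ℝ≥0∞) [Fact (1 ≤ p)] (hp : p ≠ ∞) :
    ∃ Q : ℝ≥0 → Lp 𝕜 p (volume : Measure ℝ) →L[𝕜] Lp 𝕜 p (volume : Measure ℝ),
      -- `Q_t u(x) = ∫ u(x+y) μ_t(dy)`
      (∀ (t : ℝ≥0) (u : Lp 𝕜 p (volume : Measure ℝ)),
        (∀ᵐ x : ℝ, Integrable (fun y : ℝ≥0 => u (x + (y : ℝ))) (transitionProb P σ t)) ∧
        Q t u =ᵐ[volume] fun x : ℝ => ∫ y : ℝ≥0, u (x + (y : ℝ)) ∂(transitionProb P σ t)) ∧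
      -- `Q` is the translation semigroup subordinated in the sense of Bochner
      (∀ (t : ℝ≥0) (u : Lp 𝕜 p (volume : Measure ℝ)),
        Integrable (fun s => leftTranslation 𝕜 p s u) (transitionProb P σ t) ∧
        Q t u = ∫ s, leftTranslation 𝕜 p s u ∂(transitionProb P σ t)) ∧
      -- `Q` is a contractive strongly continuous semigroup on `L^p`
      IsC0Semigroup Q ∧ (∀ t, ‖Q t‖ ≤ 1) ∧
      -- for `u ∈ W^{1,p}`, `Q_t u` is the solution of the initial value problem
      (∀ u : Lp 𝕜 p (volume : Measure ℝ), InW1p u →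
        IsSolution a b νbar u (fun t : ℝ => Q t.toNNReal u) ∧
        ∀ q : ℝ → Lp 𝕜 p (volume : Measure ℝ), IsSolution a b νbar u q →
          ∀ t : ℝ≥0, q t = Q t u) ∧
      -- on `W^{1,p}`, the generator of `Q`, Phillips' `-f(-∂/∂x)` and `-D` coincide
      (∀ u du : Lp 𝕜 p (volume : Measure ℝ), HasSpaceDeriv u du →
        IsGeneratorValue (leftTranslation 𝕜 p) u du ∧
        Integrable (fun s => leftTranslation 𝕜 p s u - u) νbar ∧
        IsGeneratorValue Q u (phillips a b νbar (leftTranslation 𝕜 p) u du) ∧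
        IsLeftWeylDeriv a b νbar u (-(phillips a b νbar (leftTranslation 𝕜 p) u du))) := by
  set μ := transitionProb P σ
  have hμ := fun (t : ℝ≥0) (r : ℝ) (hr : 0 ≤ r) => hexp.laplace_eq hf t hr
  have hT := isC0Semigroup_leftTranslation (𝕜 := 𝕜) hp
  have hc := norm_leftTranslation_le (𝕜 := 𝕜) (p := p)
  set Q : ℝ≥0 → Lp 𝕜 p (volume : Measure ℝ) →L[𝕜] Lp 𝕜 p (volume : Measure ℝ) :=
    fun t => subordinate hT hc (μ t) with hQdef
  have hQ : IsC0Semigroup Q := isC0Semigroup_subordinate hT hc hμ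
  have hQ1 : ∀ t, ‖Q t‖ ≤ 1 := norm_subordinate_le_one hT hc hf hμ
  have hQc : ∀ t u, ‖Q t u‖ ≤ ‖u‖ := fun t u => by
    simpa using (Q t).le_of_opNorm_le (hQ1 t) u
  have hgen : ∀ u du : Lp 𝕜 p (volume : Measure ℝ), HasSpaceDeriv u du →
      IsGeneratorValue Q u (phillips a b νbar (leftTranslation 𝕜 p) u du) := fun u du h =>
    isGeneratorValue_subordinate hT hc hf hμ (h.isGeneratorValue hp)
  refine ⟨Q, fun t u => subordinate_leftTranslation_eval hp (μ t) (Lp.stronglyMeasurable u)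
    EventuallyEq.rfl, fun t u => ⟨hT.integrable_orbit hc (μ t) u, rfl⟩, hQ, hQ1,
    fun u hu => ⟨⟨?_, ?_, fun t ht => ?_⟩, fun q hq t => ?_⟩,
    fun u du h => ⟨h.isGeneratorValue hp,
      integrable_orbit_sub hT hc hf (h.isGeneratorValue hp), hgen u du h,
      hf.isLeftWeylDeriv hp h⟩⟩
  · exact ((hQ.continuous_orbit hQc u).comp continuous_real_toNNReal).continuousOn
  · rw [Real.toNNReal_zero, hQ.zero_apply]
  · obtain ⟨g, hg, hug⟩ := hu
    have hu := hg.hasSpaceDeriv hug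
    have hQu : HasSpaceDeriv (Q t.toNNReal u) (Q t.toNNReal (hg.memLp_deriv.toLp (deriv g))) :=
      hasSpaceDeriv_subordinate hp (μ t.toNNReal) hu
    refine ⟨_, hf.isLeftWeylDeriv hp hQu, ?_⟩
    -- The generator at `Q_t u` has two expressions: Phillips' formula for `Q_t u`, and `Q_t`
    -- applied to Phillips' formula for `u`. Limits being unique, they agree.
    rw [neg_neg, tendsto_nhds_unique (hgen _ _ hQu) ((hgen _ _ hu).map hQ t.toNNReal)]
    exact (hgen _ _ hu).hasDerivAt hQ hQc ht
  · have hex : ∀ s : ℝ, 0 < s → ∃ v, HasDerivAt q v s ∧ IsGeneratorValue Q (q s) v := by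
      intro s hs
      obtain ⟨w, hw, hd⟩ := hq.equation s hs
      obtain ⟨g, hg, hqg, -⟩ := id hw
      have hqs := hg.hasSpaceDeriv hqg
      refine ⟨-w, hd, ?_⟩
      -- Uniqueness of the Weyl derivative identifies the derivative of `q` with the generator of
      -- `Q` at `q s`.
      rw [hw.unique (hf.isLeftWeylDeriv hp hqs), neg_neg]
      exact hgen _ _ hqs
    choose! v hv using hex
    rw [hQ.eq_of_hasDerivAt hQc hq.continuousOn (fun s hs => (hv s hs).1)
      (fun s hs => (hv s hs).2) t, hq.initial]
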